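/- Let $N\ge 2$. Take two copies ($L$ and $R$) of $2N$ harmonic oscillators $a_i,b_i$ ($1\le i\le N$) with $[a_i,a_j^\dagger]=[b_i,b_j^\dagger]=\delta_{ij}$ and all other commutators of these operators zero; the oscillators of the two copies commute. Let $|0\rangle$ be the vacuum of the Fock Hilbert space of all $4N$ oscillators. In each copy put $$J^z_i=\tfrac12(a_i^\dagger a_i-b_i^\dagger b_i),\quad J^+_i=a_i^\dagger b_i,\quad J^-_i=a_ib_i^\dagger,\quad E_{ij}=a_i^\dagger a_j+b_i^\dagger b_j,\quad F_{ij}=a_ib_j-a_jb_i,$$ $E_i=E_{ii}$ and $\vec J_i\cdot\vec J_j=J^z_iJ^z_j+\tfrac12(J^+_iJ^-_j+J^-_iJ^+_j)$. An intertwiner is a state annihilated by $\sum_iJ_i^z,\sum_iJ_i^\pm$. Let $\mathcal H_{j_1,\dots,j_N}$ be the space of intertwiners of one copy with $E_i=2j_i$ for all $i$, and $\mathcal H_N^{(J)}=\bigoplus_{\sum_i j_i=J}\mathcal H_{j_1,\dots,j_N}$. A $\mathrm{Spin}(4)$ intertwiner is a state of the Fock space of the $4N$ oscillators that is an intertwiner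 for both copies. All operators act on their maximal domains. Define the $\mathfrak u(N)$ simplicity constraints $$\mathcal C_{ij}=E^L_{ij}-E^R_{ji},\qquad \mathcal H_{\mathcal C}=\{\psi \text{ a Spin(4) intertwiner}:\ \mathcal C_{ij}\psi=0\ \ \forall i,j\},$$ and $|J\rangle=(f^\dagger)^J|0\rangle$ with $f^\dagger=\sum_{k,l}F^{L\dagger}_{kl}F^{R\dagger}_{kl}$, $J\in\mathbb N$. Then: 1. $\mathcal C_{ii}=E^L_i-E^R_i$, and $\mathcal C_{ii}\psi=0$ if and only if $(\vec J^L_i)^2\psi=(\vec J^R_i)^2\psi$; so the $\mathcal C_{ij}$ include the diagonal simplicity constraints. 2. $[\mathcal C_{ij},\mathcal C_{kl}]=\delta_{jk}\mathcal C_{il}-\delta_{il}\mathcal C_{kj}$ and $\mathcal C_{ij}^\dagger=\mathcal C_{ji}$. 3. A $\mathrm{Spin}(4)$ intertwiner lies in $\mathcal H_{\mathcal C}$ if and only if it is invariant under the action $(u,\bar u)$ of $\mathrm U(N)$, in which $u=e^{\alpha}$, $\alpha$ anti-Hermitian, acts by $\exp\big(\sum_{ij}\alpha_{ij}E^L_{ij}+\sum_{ij}\overline{\alpha_{ij}}E^R_{ij}\big)$.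 4. For every $J\in\mathbb N$ the vector $|J\rangle$ is nonzero and $\mathcal H_{\mathcal C}\cap\big(\mathcal H_N^{(J),L}\otimes\mathcal H_N^{(J),R}\big)=\mathbb C\,|J\rangle$ is one-dimensional. The vectors $|J\rangle$ are pairwise orthogonal, and $\mathcal H_{\mathcal C}=\bigoplus_{J}\mathbb C\,|J\rangle$ (Hilbert space direct sum). 5. Let $i\ne j$. For $\phi,\psi\in\mathcal H_{\mathcal C}$, with $\psi$ in the domains of $\vec J^L_i\cdot\vec J^L_j$, $\vec J^R_i\cdot\vec J^R_j$, $E_i^R$ and $E_j^R$, $$\langle\phi|\vec J^L_i\cdot\vec J^L_j|\psi\rangle=\langle\phi|\vec J^R_i\cdot\vec J^R_j|\psi\rangle+\langle\phi|\tfrac12(E^R_j-E^R_i)|\psi\rangle .$$ For $\phi\in\mathcal H_{\mathcal C}$ and $\psi\in\mathcal H_{\mathcal C}\cap(\mathcal H_N^{(J),L}\otimes\mathcal H_N^{(J),R})$ the difference of the left and right matrix elements is at most $J\,\|\phi\|\,\|\psi\|$ in absolute value, whereas the expectation values $\langle J|\vec J_i\cdot\vec J_j|J\rangle/\langle J|J\rangle$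 of the left and of the right scalar products are of exact order $J^2$ as $J\to\infty$. So the cross simplicity constraints $\vec J^L_i\cdot\vec J^L_j=\vec J^R_i\cdot\vec J^R_j$ hold weakly on $\mathcal H_{\mathcal C}$ at leading order, up to corrections of order $J$. -/

import Mathlib

noncomputable section

namespace SimplicityUN

/-! ### Harmonic oscillators

A (possibly non-normalisable) state of a family of harmonic oscillators labelled by `M` is given by
its coefficients in the orthonormal occupation number basis `|n⟩`, `n : M → ℕ`. The normalisable
states are the square-summable ones; they form the Fock Hilbert space. Every operator below is a
polynomial in creation and annihilation operators, hence acts on all coefficient families; as an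
operator on the Hilbert space it is used on its maximal domain. -/

/-- Coefficient families in the occupation number basis. -/
abbrev Amp (M : Type) : Type := (M → ℕ) → ℂ

/-- The Fock Hilbert space `ℓ²` of the oscillators labelled by `M`. -/
abbrev Fock (M : Type) : Type := lp (fun _ : M → ℕ => ℂ) 2

/-- The coefficients of a vector of the Fock space. -/
def amp (M : Type) : Fock M →ₗ[ℂ] Amp M where
  toFun ψ := fun n => ψ n
  map_add' _ _ := rfl
  map_smul' _ _ := rfl

section Oscillators

variable {M : Type} [DecidableEq M]

/-- The annihilation operator: `a_m |n⟩ = √(n_m) |n - e_m⟩`. -/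
def ann (m : M) : Module.End ℂ (Amp M) where
  toFun ψ := fun n => (Real.sqrt ((n m : ℝ) + 1) : ℂ) * ψ (n + Pi.single m 1)
  map_add' φ ψ := by funext n; simp [mul_add]
  map_smul' c ψ := by funext n; simp [mul_left_comm]

/-- The creation operator: `a_m† |n⟩ = √(n_m + 1) |n + e_m⟩`. -/
def cre (m : M) : Module.End ℂ (Amp M) where
  toFun ψ := fun n => (Real.sqrt (n m : ℝ) : ℂ) * ψ (n - Pi.single m 1)
  map_add' φ ψ := by funext n; simp [mul_add]
  map_smul' c ψ := by funext n; simp [mul_left_comm]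

open Classical in
/-- The vacuum `|0⟩`. -/
def vac (M : Type) : Amp M := Pi.single (0 : M → ℕ) (1 : ℂ)

/-- The matrix element `⟨φ|χ⟩ = ∑ₙ conj (φ n) χ n`, an absolutely convergent sum as soon as both
families are square-summable. -/
def braket (φ χ : Amp M) : ℂ := ∑' n, starRingEnd ℂ (φ n) * χ n

/-- Membership in the Fock space. -/
def Normalizable (ψ : Amp M) : Prop := Memℓp ψ 2

/-- Oscillator labels of an `N`-legged vertex: `(i, 0)` is `a_i`, `(i, 1)` is `b_i`. -/
abbrev Mode (N : ℕ) : Type := Fin N × Fin 2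

/-! ### Schwinger representation

The operators are built from the oscillators `a_i = e (i, 0)`, `b_i = e (i, 1)`, where
`e : Mode N → M` picks out a set of `2N` oscillators among those labelled by `M`. -/

variable {N : ℕ} (e : Mode N → M)

/-- `J^z_i = ½ (a_i† a_i - b_i† b_i)`. -/
def Jz (i : Fin N) : Module.End ℂ (Amp M) :=
  (1 / 2 : ℂ) • (cre (e (i, 0)) * ann (e (i, 0)) - cre (e (i, 1)) * ann (e (i, 1)))

/-- `J^+_i = a_i† b_i`. -/
def Jp (i : Fin N) : Module.End ℂ (Amp M) := cre (e (i, 0)) * ann (e (i, 1))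

/-- `J^-_i = a_i b_i†`. -/
def Jm (i : Fin N) : Module.End ℂ (Amp M) := ann (e (i, 0)) * cre (e (i, 1))

/-- The scalar product `J_i · J_j = J^z_i J^z_j + ½ (J^+_i J^-_j + J^-_i J^+_j)`; for `i = j` this
is the Casimir operator `(J_i)²`. -/
def JJ (i j : Fin N) : Module.End ℂ (Amp M) :=
  Jz e i * Jz e j + (1 / 2 : ℂ) • (Jp e i * Jm e j + Jm e i * Jp e j)

/-- `E_ij = a_i† a_j + b_i† b_j`. -/
def E (i j : Fin N) : Module.End ℂ (Amp M) :=
  cre (e (i, 0)) * ann (e (j, 0)) + cre (e (i, 1)) * ann (e (j, 1))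

/-- `F_ij† = a_i† b_j† - a_j† b_i†`, the adjoint of `F_ij = a_i b_j - a_j b_i`. -/
def Fdag (i j : Fin N) : Module.End ℂ (Amp M) :=
  cre (e (i, 0)) * cre (e (j, 1)) - cre (e (j, 0)) * cre (e (i, 1))

/-- Coefficient families that are invariant under the global `SU(2)` action, i.e. annihilated by its
generators `∑ J^z_i`, `∑ J^+_i`, `∑ J^-_i`. -/
def su2Invariants : Submodule ℂ (Amp M) :=
  LinearMap.ker (∑ i, Jz e i) ⊓ LinearMap.ker (∑ i, Jp e i) ⊓ LinearMap.ker (∑ i, Jm e i)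

end Oscillators

/-! ### Intertwiner spaces -/

/-- `Inv[V^{j_1} ⊗ ⋯ ⊗ V^{j_N}]` with `k i = 2 j_i`: the `SU(2)`-invariant states with
`E_ii = 2 j_i` on every leg. -/
def intertwiners {N : ℕ} (k : Fin N → ℕ) : Submodule ℂ (Amp (Mode N)) :=
  su2Invariants (id : Mode N → Mode N) ⊓
    ⨅ i, LinearMap.ker (E (id : Mode N → Mode N) i i - (k i : ℂ) • (1 : Module.End ℂ _))

/-- `H_N^{(J)}`: the sum of the intertwiner spaces with total area `∑ j_i = J`. -/
def areaSpace (N J : ℕ) : Submodule ℂ (Amp (Mode N)) :=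
  ⨆ (k : Fin N → ℕ) (_ : ∑ i, k i = 2 * J), intertwiners k

/-- Oscillators of a `Spin(4)` vertex: the left copy `Sum.inl` and the right copy `Sum.inr`. -/
abbrev Mode4 (N : ℕ) : Type := Mode N ⊕ Mode N

/-- Embedding of the left oscillators. -/
abbrev L (N : ℕ) : Mode N → Mode4 N := Sum.inl

/-- Embedding of the right oscillators. -/
abbrev R (N : ℕ) : Mode N → Mode4 N := Sum.inr

/-- The product state `φ ⊗ χ` of a left and a right state. -/
def tens {N : ℕ} (φ χ : Amp (Mode N)) : Amp (Mode4 N) :=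
  fun n => φ (n ∘ Sum.inl) * χ (n ∘ Sum.inr)

/-- `H_N^{(J),L} ⊗ H_N^{(J),R}`, as a subspace of the Fock space of all `4N` oscillators. -/
def sector (N J : ℕ) : Submodule ℂ (Fock (Mode4 N)) :=
  (Submodule.span ℂ (Set.image2 tens (areaSpace N J : Set (Amp (Mode N)))
    (areaSpace N J : Set (Amp (Mode N))))).comap (amp (Mode4 N))

/-- The Hilbert space of `Spin(4)` intertwiners: Fock states that are invariant under
`SU(2)_L × SU(2)_R`. -/
def spin4Intertwiners (N : ℕ) : Submodule ℂ (Fock (Mode4 N)) :=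
  (su2Invariants (L N) ⊓ su2Invariants (R N)).comap (amp (Mode4 N))

/-! ### The constraints and their solutions -/

/-- The `u(N)` simplicity constraints `C_ij = E^L_ij - E^R_ji`. -/
def C {N : ℕ} (i j : Fin N) : Module.End ℂ (Amp (Mode4 N)) := E (L N) i j - E (R N) j i

/-- `H_C`: the `Spin(4)` intertwiners annihilated by every `C_ij`. -/
def HC (N : ℕ) : Submodule ℂ (Fock (Mode4 N)) :=
  spin4Intertwiners N ⊓ (⨅ i : Fin N, ⨅ j : Fin N, LinearMap.ker (C i j)).comap (amp (Mode4 N))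

/-- The generator `∑ α_ij E^L_ij + ∑ conj(α_ij) E^R_ij` of the action of `(u, ū)` for
`u = exp α`. -/
def uGen {N : ℕ} (α : Matrix (Fin N) (Fin N) ℂ) : Module.End ℂ (Amp (Mode4 N)) :=
  ∑ i, ∑ j, (α i j • E (L N) i j + starRingEnd ℂ (α i j) • E (R N) i j)

/-- Invariance under the action of `U(N)` through `(u, ū)`: for every anti-Hermitian `α`, the
exponential series of `uGen α` applied to `ψ` converges, coefficient by coefficient, to `ψ`. (The
generator preserves the finite-dimensional spaces with given total left and right occupation
numbers, so that this series is the unitary operator `exp (uGen α)` applied to `ψ`.) -/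
def IsUNInvariant {N : ℕ} (ψ : Amp (Mode4 N)) : Prop :=
  ∀ α : Matrix (Fin N) (Fin N) ℂ, α.conjTranspose = -α →
    HasSum (fun k : ℕ => ((k.factorial : ℂ)⁻¹) • (uGen α ^ k) ψ) ψ

/-- `f† = ∑_{kl} F^{L†}_kl F^{R†}_kl`. -/
def fdag (N : ℕ) : Module.End ℂ (Amp (Mode4 N)) :=
  ∑ k : Fin N, ∑ l : Fin N, Fdag (L N) k l * Fdag (R N) k l

/-- Coefficients of `|J⟩ = (f†)^J |0⟩`. -/
def ketAmp (N J : ℕ) : Amp (Mode4 N) := (fdag N ^ J) (vac (Mode4 N))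

/-- The finitely supported coefficient families. -/
def finAmp (M : Type) : Submodule ℂ (Amp M) where
  carrier := {ψ | ψ.support.Finite}
  zero_mem' := by simp
  add_mem' := fun {φ ψ} hφ hψ => (hφ.union hψ).subset (Function.support_add φ ψ)
  smul_mem' := fun c ψ hψ => Set.Finite.subset hψ (Function.support_const_smul_subset c ψ)

lemma cre_mem_finAmp {M : Type} [DecidableEq M] (m : M) {ψ : Amp M} (h : ψ ∈ finAmp M) :
    cre m ψ ∈ finAmp M := by
  refine Set.Finite.subset (Set.Finite.image (fun n => n + Pi.single m 1) h) ?_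
  intro n hn
  have hn' : (Real.sqrt (n m : ℝ) : ℂ) * ψ (n - Pi.single m 1) ≠ 0 := hn
  have h1 : n m ≠ 0 := by
    intro h0
    exact hn' (by simp [h0])
  refine ⟨n - Pi.single m 1, right_ne_zero_of_mul hn', ?_⟩
  funext k
  by_cases hk : k = m
  · subst hk
    simp
    omega
  · simp [hk]

lemma Fdag_mem_finAmp {M : Type} [DecidableEq M] {N : ℕ} (e : Mode N → M) (i j : Fin N)
    {ψ : Amp M} (h : ψ ∈ finAmp M) : Fdag e i j ψ ∈ finAmp M :=
  Submodule.sub_mem _ (cre_mem_finAmp _ (cre_mem_finAmp _ h))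
    (cre_mem_finAmp _ (cre_mem_finAmp _ h))

lemma ketAmp_mem_finAmp (N J : ℕ) : ketAmp N J ∈ finAmp (Mode4 N) := by
  induction J with
  | zero =>
    refine Set.Finite.subset (Set.finite_singleton (0 : Mode4 N → ℕ)) ?_
    intro n hn
    by_contra h
    have h' : n ≠ 0 := h
    exact hn (by simp [ketAmp, vac, h'])
  | succ J ih =>
    have hs : ketAmp N (J + 1) = fdag N (ketAmp N J) := by
      simp [ketAmp, pow_succ']
    rw [hs, fdag, LinearMap.sum_apply]
    refine Submodule.sum_mem _ fun k _ => ?_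
    rw [LinearMap.sum_apply]
    exact Submodule.sum_mem _ fun l _ => Fdag_mem_finAmp _ _ _ (Fdag_mem_finAmp _ _ _ ih)

/-- The vector `|J⟩ = (f†)^J |0⟩` of the Fock space. -/
def ket (N J : ℕ) : Fock (Mode4 N) :=
  ⟨ketAmp N J, (memℓp_zero (ketAmp_mem_finAmp N J)).of_exponent_ge (zero_le)⟩

/-- The normalised expectation value `⟨J|A|J⟩ / ⟨J|J⟩`. -/
def expect {N : ℕ} (J : ℕ) (A : Module.End ℂ (Amp (Mode4 N))) : ℂ :=
  braket (ketAmp N J) (A (ketAmp N J)) / braket (ketAmp N J) (ketAmp N J)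

end SimplicityUN

end

/-! All operators are polynomials in creation and annihilation operators, so every identity is
proved by normal ordering on arbitrary coefficient families; the Hilbert space enters only through
orthogonality, closedness and norms.

The heart is that `solutions N` has one dimension per area. On a solution the constraints replace
`E^R_ji` by `E^L_ij`. Since `F†_kl F_mn` is quadratic in the `E`s (`Fdag_mul_Fann`), the right
bilinear acts as a left one with its index pairs exchanged (`Fdag_Fann_R_apply`). So `f†f` becomes a
purely left contraction, which on `SU(2)` invariants with `∑ a†a = c` is the scalar
`4c(c+1)(c+N-1)(c+N-2)` (`fdag_fann_apply`). It is nonzero for `c ≥ 1`, `N ≥ 2`. As `f` commutes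
with the constraints and lowers the area by one, induction writes every solution of area `J` as a
multiple of `(f†)^J |0⟩` (`exists_smul_ketAmp`). One explicit coefficient, `2^J (J!)^2`, shows `|J⟩
≠ 0` (`ketAmp_extremal`).

Area projections preserve solutions, so a solution is determined by its components along the `|J⟩`;
with `HC N` closed this gives the Hilbert sum. `U(N)` invariance is differentiated along
one-parameter groups, coefficient by coefficient (`isUNInvariant_iff`).

For `i ≠ j` the scalar product is a polynomial in the `E`s that transposition leaves unchanged on
solutions, so left and right products agree exactly (`JJ_L_apply`). The term `½(E^R_j - E^R_i)` has
zero matrix elements because solutions are symmetric under leg permutations (`permOp_solution`). The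
same symmetry and the closure condition reduce the expectation of `J_i·J_j` to the mean Casimir,
which is bounded by Cauchy–Schwarz. -/

noncomputable section

namespace SimplicityUN

set_option linter.unusedSimpArgs false
set_option linter.unreachableTactic false
set_option linter.unusedTactic false

/-! ### Canonical commutation relations -/

section CCR

variable {M : Type} [DecidableEq M]

lemma cre_apply (m : M) (ψ : Amp M) (n : M → ℕ) :
    cre m ψ n = (Real.sqrt (n m : ℝ) : ℂ) * ψ (n - Pi.single m 1) := rfl

lemma ann_apply (m : M) (ψ : Amp M) (n : M → ℕ) :
    ann m ψ n = (Real.sqrt ((n m : ℝ) + 1) : ℂ) * ψ (n + Pi.single m 1) := rfl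

lemma sqrt_mul_sqrt_nat (k : ℕ) : (Real.sqrt (k : ℝ) : ℂ) * (Real.sqrt (k : ℝ) : ℂ) = k := by
  rw [← Complex.ofReal_mul, Real.mul_self_sqrt (Nat.cast_nonneg k), Complex.ofReal_natCast]

lemma cre_mul_cre (x y : M) : (cre x * cre y : Module.End ℂ (Amp M)) = cre y * cre x := by
  rcases eq_or_ne x y with rfl | h
  · rfl
  refine LinearMap.ext fun ψ => funext fun n => ?_
  simp only [Module.End.mul_apply, cre_apply, Pi.sub_apply, Pi.single_eq_of_ne h,
    Pi.single_eq_of_ne h.symm, Nat.sub_zero, tsub_right_comm (a := n) (b := Pi.single x 1)]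
  ring

lemma ann_mul_ann (x y : M) : (ann x * ann y : Module.End ℂ (Amp M)) = ann y * ann x := by
  rcases eq_or_ne x y with rfl | h
  · rfl
  refine LinearMap.ext fun ψ => funext fun n => ?_
  simp only [Module.End.mul_apply, ann_apply, Pi.add_apply, Pi.single_eq_of_ne h,
    Pi.single_eq_of_ne h.symm, Nat.add_zero, add_right_comm n (Pi.single x 1)]
  ring

lemma sub_single_add_single {n : M → ℕ} {x : M} (h : n x ≠ 0) :
    n - Pi.single x 1 + Pi.single x 1 = n := by
  refine tsub_add_cancel_of_le fun k => ?_
  by_cases hk : k = x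
  · subst hk; simp; omega
  · simp [hk]

lemma cre_mul_ann_self_apply (x : M) (ψ : Amp M) (n : M → ℕ) :
    (cre x * ann x : Module.End ℂ (Amp M)) ψ n = (n x : ℂ) * ψ n := by
  simp only [Module.End.mul_apply, ann_apply, cre_apply]
  by_cases h : n x = 0
  · simp [h]
  · rw [sub_single_add_single h]
    have : ((n - Pi.single x 1 : M → ℕ) x : ℝ) + 1 = n x := by
      have : (n - Pi.single x 1 : M → ℕ) x + 1 = n x := by simp; omega
      exact_mod_cast this
    rw [this, ← mul_assoc, sqrt_mul_sqrt_nat]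

lemma ann_mul_cre (x y : M) :
    (ann x * cre y : Module.End ℂ (Amp M)) = cre y * ann x + if x = y then 1 else 0 := by
  refine LinearMap.ext fun ψ => funext fun n => ?_
  rcases eq_or_ne x y with rfl | h
  · rw [if_pos rfl, LinearMap.add_apply, Pi.add_apply, cre_mul_ann_self_apply]
    simp only [Module.End.mul_apply, ann_apply, cre_apply, add_tsub_cancel_right, Pi.add_apply,
      Pi.single_eq_same, Module.End.one_apply]
    rw [← Nat.cast_succ, ← mul_assoc, sqrt_mul_sqrt_nat]
    push_cast; ring
  · rw [if_neg h, add_zero]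
    simp only [Module.End.mul_apply, ann_apply, cre_apply, Pi.add_apply, Pi.sub_apply,
      Pi.single_eq_of_ne h, Pi.single_eq_of_ne h.symm, Nat.sub_zero, Nat.add_zero]
    -- Subtraction of occupation numbers is truncated; where it would fail, the square root in front
    -- vanishes.
    by_cases hy : n y = 0
    · simp [hy]
    · have : n + Pi.single x 1 - Pi.single y 1 = n - Pi.single y 1 + Pi.single x 1 := by
        rw [← sub_single_add_single hy, add_right_comm, add_tsub_cancel_right,
          add_tsub_cancel_right]
      rw [this]; ring

/-- With an arbitrary tail `T`, the relations rewrite inside right-associated words, so that `simp`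
can bring any polynomial to normal order. -/
lemma cre_mul_cre_mul (x y : M) (T : Module.End ℂ (Amp M)) :
    cre x * (cre y * T) = cre y * (cre x * T) := by
  rw [← mul_assoc, cre_mul_cre, mul_assoc]

lemma ann_mul_ann_mul (x y : M) (T : Module.End ℂ (Amp M)) :
    ann x * (ann y * T) = ann y * (ann x * T) := by
  rw [← mul_assoc, ann_mul_ann, mul_assoc]

lemma ann_mul_cre_mul (x y : M) (T : Module.End ℂ (Amp M)) :
    ann x * (cre y * T) = cre y * (ann x * T) + if x = y then T else 0 := by
  rw [← mul_assoc, ann_mul_cre, add_mul, mul_assoc]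
  split_ifs <;> simp

end CCR

/-! ### Commutators of `E`, `F`, `F†` and the `SU(2)` generators -/

section Algebra

variable {M : Type} [DecidableEq M] {N : ℕ} (e : Mode N → M)

/-- `F_ij = a_i b_j - a_j b_i`. -/
def Fann (i j : Fin N) : Module.End ℂ (Amp M) :=
  ann (e (i, 0)) * ann (e (j, 1)) - ann (e (j, 0)) * ann (e (i, 1))

/-- The total number of oscillators of type `s`. -/
def numTot (s : Fin 2) : Module.End ℂ (Amp M) :=
  ∑ i, cre (e (i, s)) * ann (e (i, s))

lemma sum_Jz_eq :
    ∑ i, Jz e i = (1 / 2 : ℂ) • (numTot e 0 - numTot e 1) := by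
  simp only [Jz, numTot, ← Finset.smul_sum, Finset.sum_sub_distrib]

lemma sum_E_eq : ∑ i, E e i i = numTot e 0 + numTot e 1 := by
  simp only [E, numTot, Finset.sum_add_distrib]

variable {e} (he : Function.Injective e)
include he

lemma E_bracket (i j k l : Fin N) :
    E e i j * E e k l - E e k l * E e i j =
      (if j = k then E e i l else 0) - (if i = l then E e k j else 0) := by
  simp only [E, mul_add, add_mul, mul_assoc, ann_mul_cre_mul, ann_mul_cre, he.eq_iff,
    Prod.mk.injEq, and_true, and_false, if_false, add_zero, one_ne_zero, zero_ne_one, mul_ite,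
    mul_zero]
  simp only [cre_mul_cre_mul, ann_mul_ann, cre_mul_cre]
  -- Identifying indices can change how `simp` orders commuting factors, hence the second sorting
  -- pass in each case.
  split_ifs <;> subst_vars <;>
    first | omega | ((try simp only [cre_mul_cre_mul, ann_mul_ann, cre_mul_cre]); abel)

lemma E_bracket_Fdag (i j k l : Fin N) :
    E e i j * Fdag e k l - Fdag e k l * E e i j =
      (if j = k then Fdag e i l else 0) + (if j = l then Fdag e k i else 0) := by
  simp only [E, Fdag, mul_add, add_mul, mul_sub, sub_mul, mul_assoc, ann_mul_cre_mul, ann_mul_cre,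
    he.eq_iff, mul_ite, mul_one, mul_zero,
    Prod.mk.injEq, and_true, and_false, if_false, add_zero, one_ne_zero, zero_ne_one]
  simp only [cre_mul_cre_mul, ann_mul_ann, cre_mul_cre]
  split_ifs <;> subst_vars <;>
    first | omega | ((try simp only [cre_mul_cre_mul, ann_mul_ann, cre_mul_cre]); abel)

lemma E_bracket_Fann (i j k l : Fin N) :
    E e i j * Fann e k l =
      Fann e k l * E e i j - (if i = k then Fann e j l else 0)
        - (if i = l then Fann e k j else 0) := by
  simp only [E, Fann, mul_add, add_mul, mul_sub, sub_mul, mul_assoc, ann_mul_cre_mul, ann_mul_cre,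
    he.eq_iff, mul_ite, mul_one, mul_zero,
    Prod.mk.injEq, and_true, and_false, if_false, add_zero, one_ne_zero, zero_ne_one]
  simp only [ann_mul_ann_mul, ann_mul_ann]
  split_ifs <;> subst_vars <;>
    first | omega | ((try simp only [ann_mul_ann_mul, ann_mul_ann]); abel)

/-- A normal-ordered `2 × 2` minor of the matrix `E`. It lets constraints on `E` act on products of
`F†` and `F`. -/
lemma Fdag_mul_Fann (k l m n : Fin N) :
    Fdag e k l * Fann e m n = E e k m * E e l n - (if m = l then E e k n else 0)
      - E e k n * E e l m + (if n = l then E e k m else 0) := by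
  simp only [E, Fdag, Fann, mul_add, add_mul, mul_sub, sub_mul, mul_assoc, ann_mul_cre_mul,
    ann_mul_cre,
    he.eq_iff, mul_ite, mul_one, mul_zero,
    Prod.mk.injEq, and_true, and_false, if_false, add_zero, one_ne_zero, zero_ne_one]
  simp only [cre_mul_cre_mul, ann_mul_ann, cre_mul_cre]
  split_ifs <;> subst_vars <;>
    first | omega | ((try simp only [cre_mul_cre_mul, ann_mul_ann, cre_mul_cre]); abel)

/-- The correction at `m = n` accounts for `F_mm = 0`, so that the identity can be summed over all
pairs. -/
lemma Fann_mul_Fdag_self (m n : Fin N) :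
    Fann e m n * Fdag e m n = Fdag e m n * Fann e m n + E e m m + E e n n + 2
      - (if m = n then 2 * E e m m + 2 else 0) := by
  simp only [E, Fdag, Fann, mul_add, add_mul, mul_sub, sub_mul, mul_assoc, ann_mul_cre_mul,
    ann_mul_cre,
    he.eq_iff, mul_ite, mul_one, mul_zero,
    Prod.mk.injEq, and_true, and_false, if_false, add_zero, one_ne_zero, zero_ne_one, if_true]
  simp only [cre_mul_cre_mul, ann_mul_ann, cre_mul_cre, ann_mul_ann_mul]
  simp only [show (2 : Module.End ℂ (Amp M)) = 1 + 1 from one_add_one_eq_two.symm, add_mul, one_mul]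
  split_ifs <;> subst_vars <;>
    first | omega | ((try simp only [cre_mul_cre_mul, ann_mul_ann, cre_mul_cre, ann_mul_ann_mul]); abel)

/-- Arranged so that summing over `k, l` produces products of the global generators `∑ J^+` and `∑
J^-`, the latter on the right, where it kills invariants. -/
lemma Fdag_mul_Fann_self (k l : Fin N) :
    Fdag e k l * Fann e k l =
      cre (e (k, 0)) * ann (e (k, 0)) * (cre (e (l, 1)) * ann (e (l, 1)))
      + cre (e (l, 0)) * ann (e (l, 0)) * (cre (e (k, 1)) * ann (e (k, 1)))
      - Jp e k * Jm e l - Jp e l * Jm e k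
      + (if k = l then 2 * (cre (e (k, 0)) * ann (e (k, 0))) else 0) := by
  simp only [Jp, Jm, Fdag, Fann, mul_add, add_mul, mul_sub, sub_mul, mul_assoc, ann_mul_cre_mul,
    ann_mul_cre,
    he.eq_iff, mul_ite, mul_one, mul_zero,
    Prod.mk.injEq, and_true, and_false, if_false, add_zero, one_ne_zero, zero_ne_one, if_true]
  simp only [cre_mul_cre_mul, ann_mul_ann, cre_mul_cre, ann_mul_ann_mul]
  simp only [show (2 : Module.End ℂ (Amp M)) = 1 + 1 from one_add_one_eq_two.symm, add_mul, one_mul]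
  split_ifs <;> subst_vars <;>
    first | omega | ((try simp only [cre_mul_cre_mul, ann_mul_ann, cre_mul_cre, ann_mul_ann_mul]); abel)

/-- Expressing the scalar product through `E` alone is what allows the constraints to be applied to
it. -/
lemma JJ_eq_of_ne {i j : Fin N} (h : i ≠ j) :
    JJ e i j = (1 / 2 : ℂ) • (E e i j * E e j i) - (1 / 4 : ℂ) • (E e i i * E e j j)
      - (1 / 2 : ℂ) • E e i i := by
  simp only [JJ, Jp, Jm, Jz, E, mul_add, add_mul, mul_sub, sub_mul, mul_assoc, ann_mul_cre_mul,
    ann_mul_cre, smul_mul_assoc, mul_smul_comm, smul_smul, smul_add, smul_sub,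
    he.eq_iff, mul_ite, mul_one, mul_zero, h, h.symm,
    Prod.mk.injEq, and_true, and_false, if_false, add_zero, one_ne_zero, zero_ne_one, if_true]
  simp only [cre_mul_cre_mul, ann_mul_ann, cre_mul_cre, ann_mul_ann_mul]
  module

/-- `F_kl` is an `SU(2)` singlet: single-leg commutators leave terms `b_l b_k` and `b_k b_l`, which
cancel in the sum over legs. -/
lemma sum_Jp_mul_Fann (k l : Fin N) :
    (∑ i, Jp e i) * Fann e k l = Fann e k l * ∑ i, Jp e i := by
  have h : ∀ i, Jp e i * Fann e k l = Fann e k l * Jp e i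
      - (if k = i then ann (e (l, 1)) * ann (e (i, 1)) else 0)
      + (if l = i then ann (e (k, 1)) * ann (e (i, 1)) else 0) := fun i => by
    simp only [Jp, Fann, mul_add, add_mul, mul_sub, sub_mul, mul_assoc, ann_mul_cre_mul,
      ann_mul_cre, he.eq_iff, mul_ite, mul_one, mul_zero,
      Prod.mk.injEq, and_true, and_false, if_false, add_zero, one_ne_zero, zero_ne_one, if_true]
    simp only [ann_mul_ann, ann_mul_ann_mul]
    abel
  simp only [Finset.sum_mul, h, Finset.sum_add_distrib, Finset.sum_sub_distrib, Finset.sum_ite_eq,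
    Finset.mem_univ, if_true, Finset.mul_sum, ann_mul_ann (e (l, 1))]
  abel

lemma sum_Jm_mul_Fann (k l : Fin N) :
    (∑ i, Jm e i) * Fann e k l = Fann e k l * ∑ i, Jm e i := by
  have h : ∀ i, Jm e i * Fann e k l = Fann e k l * Jm e i
      - (if l = i then ann (e (k, 0)) * ann (e (i, 0)) else 0)
      + (if k = i then ann (e (l, 0)) * ann (e (i, 0)) else 0) := fun i => by
    simp only [Jm, Fann, mul_add, add_mul, mul_sub, sub_mul, mul_assoc, ann_mul_cre_mul,
      ann_mul_cre, he.eq_iff, mul_ite, mul_one, mul_zero,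
      Prod.mk.injEq, and_true, and_false, if_false, add_zero, one_ne_zero, zero_ne_one, if_true]
    simp only [ann_mul_ann, ann_mul_ann_mul]
    abel
  simp only [Finset.sum_mul, h, Finset.sum_add_distrib, Finset.sum_sub_distrib, Finset.sum_ite_eq,
    Finset.mem_univ, if_true, Finset.mul_sum, ann_mul_ann (e (l, 0))]
  abel


lemma sum_Jp_mul_Fdag (k l : Fin N) :
    (∑ i, Jp e i) * Fdag e k l = Fdag e k l * ∑ i, Jp e i := by
  have h : ∀ i, Jp e i * Fdag e k l = Fdag e k l * Jp e i
      + (if i = l then cre (e (k, 0)) * cre (e (i, 0)) else 0)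
      - (if i = k then cre (e (l, 0)) * cre (e (i, 0)) else 0) := fun i => by
    simp only [Jp, Jm, Fdag, mul_add, add_mul, mul_sub, sub_mul, mul_assoc, ann_mul_cre_mul,
      ann_mul_cre, he.eq_iff, mul_ite, mul_one, mul_zero,
      Prod.mk.injEq, and_true, and_false, if_false, add_zero, one_ne_zero, zero_ne_one, if_true]
    simp only [ann_mul_ann, ann_mul_ann_mul, cre_mul_cre, cre_mul_cre_mul]
    split_ifs <;> subst_vars <;> (try simp only [cre_mul_cre]) <;> abel
  simp only [Finset.sum_mul, h, Finset.sum_add_distrib, Finset.sum_sub_distrib, Finset.sum_ite_eq',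
    Finset.mem_univ, if_true, Finset.mul_sum, cre_mul_cre (e (l, 0))]
  abel

lemma sum_Jm_mul_Fdag (k l : Fin N) :
    (∑ i, Jm e i) * Fdag e k l = Fdag e k l * ∑ i, Jm e i := by
  have h : ∀ i, Jm e i * Fdag e k l = Fdag e k l * Jm e i
      + (if i = k then cre (e (l, 1)) * cre (e (i, 1)) else 0)
      - (if i = l then cre (e (k, 1)) * cre (e (i, 1)) else 0) := fun i => by
    simp only [Jp, Jm, Fdag, mul_add, add_mul, mul_sub, sub_mul, mul_assoc, ann_mul_cre_mul,
      ann_mul_cre, he.eq_iff, mul_ite, mul_one, mul_zero,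
      Prod.mk.injEq, and_true, and_false, if_false, add_zero, one_ne_zero, zero_ne_one, if_true]
    simp only [ann_mul_ann, ann_mul_ann_mul, cre_mul_cre, cre_mul_cre_mul]
    split_ifs <;> subst_vars <;> (try simp only [cre_mul_cre]) <;> abel
  simp only [Finset.sum_mul, h, Finset.sum_add_distrib, Finset.sum_sub_distrib, Finset.sum_ite_eq',
    Finset.mem_univ, if_true, Finset.mul_sum, cre_mul_cre (e (l, 1))]
  abel



lemma numTot_zero_mul_Fann (k l : Fin N) :
    numTot e 0 * Fann e k l = Fann e k l * numTot e 0 - Fann e k l := by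
  have h : ∀ i, cre (e (i, 0)) * ann (e (i, 0)) * Fann e k l =
      Fann e k l * (cre (e (i, 0)) * ann (e (i, 0)))
      - (if k = i then ann (e (i, 0)) * ann (e (l, 1)) else 0)
      + (if l = i then ann (e (i, 0)) * ann (e (k, 1)) else 0) := fun i => by
    simp only [Fann, mul_add, add_mul, mul_sub, sub_mul, mul_assoc, ann_mul_cre_mul,
      ann_mul_cre, he.eq_iff, mul_ite, mul_one, mul_zero,
      Prod.mk.injEq, and_true, and_false, if_false, add_zero, one_ne_zero, zero_ne_one, if_true]
    simp only [ann_mul_ann, ann_mul_ann_mul, cre_mul_cre, cre_mul_cre_mul]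
    split_ifs <;> subst_vars <;> (try simp only [cre_mul_cre, ann_mul_ann]) <;> abel
  simp only [numTot, Finset.sum_mul, h, Finset.sum_add_distrib, Finset.sum_sub_distrib,
    Finset.sum_ite_eq, Finset.mem_univ, if_true, Finset.mul_sum]
  rw [Fann]
  abel

lemma numTot_zero_mul_Fdag (k l : Fin N) :
    numTot e 0 * Fdag e k l = Fdag e k l * numTot e 0 + Fdag e k l := by
  have h : ∀ i, cre (e (i, 0)) * ann (e (i, 0)) * Fdag e k l =
      Fdag e k l * (cre (e (i, 0)) * ann (e (i, 0)))
      + (if i = k then cre (e (i, 0)) * cre (e (l, 1)) else 0)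
      - (if i = l then cre (e (i, 0)) * cre (e (k, 1)) else 0) := fun i => by
    simp only [Fdag, mul_add, add_mul, mul_sub, sub_mul, mul_assoc, ann_mul_cre_mul,
      ann_mul_cre, he.eq_iff, mul_ite, mul_one, mul_zero,
      Prod.mk.injEq, and_true, and_false, if_false, add_zero, one_ne_zero, zero_ne_one, if_true]
    simp only [ann_mul_ann, ann_mul_ann_mul, cre_mul_cre, cre_mul_cre_mul]
    split_ifs <;> subst_vars <;> (try simp only [cre_mul_cre, ann_mul_ann]) <;> abel
  simp only [numTot, Finset.sum_mul, h, Finset.sum_add_distrib, Finset.sum_sub_distrib,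
    Finset.sum_ite_eq', Finset.mem_univ, if_true, Finset.mul_sum]
  rw [Fdag]
  abel

lemma numTot_one_mul_Fann (k l : Fin N) :
    numTot e 1 * Fann e k l = Fann e k l * numTot e 1 - Fann e k l := by
  have h : ∀ i, cre (e (i, 1)) * ann (e (i, 1)) * Fann e k l =
      Fann e k l * (cre (e (i, 1)) * ann (e (i, 1)))
      - (if l = i then ann (e (k, 0)) * ann (e (i, 1)) else 0)
      + (if k = i then ann (e (l, 0)) * ann (e (i, 1)) else 0) := fun i => by
    simp only [Fann, mul_add, add_mul, mul_sub, sub_mul, mul_assoc, ann_mul_cre_mul,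
      ann_mul_cre, he.eq_iff, mul_ite, mul_one, mul_zero,
      Prod.mk.injEq, and_true, and_false, if_false, add_zero, one_ne_zero, zero_ne_one, if_true]
    simp only [ann_mul_ann, ann_mul_ann_mul, cre_mul_cre, cre_mul_cre_mul]
    split_ifs <;> subst_vars <;> (try simp only [cre_mul_cre, ann_mul_ann]) <;> abel
  simp only [numTot, Finset.sum_mul, h, Finset.sum_add_distrib, Finset.sum_sub_distrib,
    Finset.sum_ite_eq, Finset.mem_univ, if_true, Finset.mul_sum]
  rw [Fann]
  abel

lemma numTot_one_mul_Fdag (k l : Fin N) :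
    numTot e 1 * Fdag e k l = Fdag e k l * numTot e 1 + Fdag e k l := by
  have h : ∀ i, cre (e (i, 1)) * ann (e (i, 1)) * Fdag e k l =
      Fdag e k l * (cre (e (i, 1)) * ann (e (i, 1)))
      + (if i = l then cre (e (k, 0)) * cre (e (i, 1)) else 0)
      - (if i = k then cre (e (l, 0)) * cre (e (i, 1)) else 0) := fun i => by
    simp only [Fdag, mul_add, add_mul, mul_sub, sub_mul, mul_assoc, ann_mul_cre_mul,
      ann_mul_cre, he.eq_iff, mul_ite, mul_one, mul_zero,
      Prod.mk.injEq, and_true, and_false, if_false, add_zero, one_ne_zero, zero_ne_one, if_true]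
    simp only [ann_mul_ann, ann_mul_ann_mul, cre_mul_cre, cre_mul_cre_mul]
    split_ifs <;> subst_vars <;> (try simp only [cre_mul_cre, ann_mul_ann]) <;> abel
  simp only [numTot, Finset.sum_mul, h, Finset.sum_add_distrib, Finset.sum_sub_distrib,
    Finset.sum_ite_eq', Finset.mem_univ, if_true, Finset.mul_sum]
  rw [Fdag]
  abel

end Algebra

/-! ### Commutation of disjoint sets of oscillators -/

section Disjoint

variable {M : Type} [DecidableEq M] {N : ℕ}

/-- The algebra generated by the oscillators `e (i, s)`. -/
def oscAlg (e : Mode N → M) : Subalgebra ℂ (Module.End ℂ (Amp M)) :=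
  Algebra.adjoin ℂ (Set.range (fun x => cre (e x)) ∪ Set.range (fun x => ann (e x)))

variable (e : Mode N → M)

lemma cre_mem_oscAlg (x : Mode N) : cre (e x) ∈ oscAlg e :=
  Algebra.subset_adjoin (Or.inl ⟨x, rfl⟩)

lemma ann_mem_oscAlg (x : Mode N) : ann (e x) ∈ oscAlg e :=
  Algebra.subset_adjoin (Or.inr ⟨x, rfl⟩)

lemma E_mem_oscAlg (i j : Fin N) : E e i j ∈ oscAlg e :=
  add_mem (mul_mem (cre_mem_oscAlg e _) (ann_mem_oscAlg e _))
    (mul_mem (cre_mem_oscAlg e _) (ann_mem_oscAlg e _))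

lemma Fdag_mem_oscAlg (i j : Fin N) : Fdag e i j ∈ oscAlg e :=
  sub_mem (mul_mem (cre_mem_oscAlg e _) (cre_mem_oscAlg e _))
    (mul_mem (cre_mem_oscAlg e _) (cre_mem_oscAlg e _))

lemma Fann_mem_oscAlg (i j : Fin N) : Fann e i j ∈ oscAlg e :=
  sub_mem (mul_mem (ann_mem_oscAlg e _) (ann_mem_oscAlg e _))
    (mul_mem (ann_mem_oscAlg e _) (ann_mem_oscAlg e _))

lemma Jz_mem_oscAlg (i : Fin N) : Jz e i ∈ oscAlg e :=
  Subalgebra.smul_mem _ (sub_mem (mul_mem (cre_mem_oscAlg e _) (ann_mem_oscAlg e _))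
    (mul_mem (cre_mem_oscAlg e _) (ann_mem_oscAlg e _))) _

lemma Jp_mem_oscAlg (i : Fin N) : Jp e i ∈ oscAlg e :=
  mul_mem (cre_mem_oscAlg e _) (ann_mem_oscAlg e _)

lemma Jm_mem_oscAlg (i : Fin N) : Jm e i ∈ oscAlg e :=
  mul_mem (ann_mem_oscAlg e _) (cre_mem_oscAlg e _)

lemma numTot_mem_oscAlg (s : Fin 2) : numTot e s ∈ oscAlg e :=
  sum_mem fun _ _ => mul_mem (cre_mem_oscAlg e _) (ann_mem_oscAlg e _)

variable {e} {e' : Mode N → M}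

lemma commute_of_mem_oscAlg (hd : ∀ x y, e x ≠ e' y) {A B : Module.End ℂ (Amp M)}
    (hA : A ∈ oscAlg e) (hB : B ∈ oscAlg e') : Commute A B := by
  refine Algebra.commute_of_mem_adjoin_of_forall_mem_commute hB fun b hb => ?_
  refine (Algebra.commute_of_mem_adjoin_of_forall_mem_commute hA fun a ha => ?_).symm
  rcases ha with ⟨x, rfl⟩ | ⟨x, rfl⟩ <;> rcases hb with ⟨y, rfl⟩ | ⟨y, rfl⟩
  · exact cre_mul_cre _ _
  · have h := ann_mul_cre (e' y) (e x)
    rw [if_neg (hd x y).symm, add_zero] at h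
    exact h
  · have h := ann_mul_cre (e x) (e' y)
    rw [if_neg (hd x y), add_zero] at h
    exact h.symm
  · exact ann_mul_ann _ _

end Disjoint

/-! ### Contractions of `F†` and `F` as scalars on invariants -/

section Casimir

variable {M : Type} [DecidableEq M] {N : ℕ} {e : Mode N → M}

lemma mem_su2Invariants_iff {ψ : Amp M} : ψ ∈ su2Invariants e ↔
    (∑ i, Jz e i) ψ = 0 ∧ (∑ i, Jp e i) ψ = 0 ∧ (∑ i, Jm e i) ψ = 0 := by
  simp only [su2Invariants, Submodule.mem_inf, LinearMap.mem_ker, and_assoc]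

lemma apply_mem_su2Invariants {ψ : Amp M} (hψ : ψ ∈ su2Invariants e) {T : Module.End ℂ (Amp M)}
    (hz : Commute (∑ i, Jz e i) T) (hp : Commute (∑ i, Jp e i) T)
    (hm : Commute (∑ i, Jm e i) T) : T ψ ∈ su2Invariants e := by
  rw [mem_su2Invariants_iff] at hψ ⊢
  refine ⟨?_, ?_, ?_⟩
  · rw [← Module.End.mul_apply, hz.eq, Module.End.mul_apply, hψ.1, map_zero]
  · rw [← Module.End.mul_apply, hp.eq, Module.End.mul_apply, hψ.2.1, map_zero]
  · rw [← Module.End.mul_apply, hm.eq, Module.End.mul_apply, hψ.2.2, map_zero]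

lemma numTot_one_apply {ψ : Amp M} (hψ : ψ ∈ su2Invariants e) :
    numTot e 1 ψ = numTot e 0 ψ := by
  have h := (mem_su2Invariants_iff.1 hψ).1
  rw [sum_Jz_eq, LinearMap.smul_apply, smul_eq_zero_iff_right (by norm_num),
    LinearMap.sub_apply, sub_eq_zero] at h
  exact h.symm

variable (he : Function.Injective e)
include he

lemma sum_Jz_commute_Fann (k l : Fin N) : Commute (∑ i, Jz e i) (Fann e k l) := by
  rw [sum_Jz_eq]
  refine Commute.smul_left ?_ _
  rw [Commute, SemiconjBy, sub_mul, mul_sub, numTot_zero_mul_Fann he, numTot_one_mul_Fann he]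
  abel

lemma sum_Jz_commute_Fdag (k l : Fin N) : Commute (∑ i, Jz e i) (Fdag e k l) := by
  rw [sum_Jz_eq]
  refine Commute.smul_left ?_ _
  rw [Commute, SemiconjBy, sub_mul, mul_sub, numTot_zero_mul_Fdag he, numTot_one_mul_Fdag he]
  abel

lemma Fann_mem_su2Invariants (k l : Fin N) {ψ : Amp M} (hψ : ψ ∈ su2Invariants e) :
    Fann e k l ψ ∈ su2Invariants e :=
  apply_mem_su2Invariants hψ (sum_Jz_commute_Fann he k l) (sum_Jp_mul_Fann he k l)
    (sum_Jm_mul_Fann he k l)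

lemma Fdag_mem_su2Invariants (k l : Fin N) {ψ : Amp M} (hψ : ψ ∈ su2Invariants e) :
    Fdag e k l ψ ∈ su2Invariants e :=
  apply_mem_su2Invariants hψ (sum_Jz_commute_Fdag he k l) (sum_Jp_mul_Fdag he k l)
    (sum_Jm_mul_Fdag he k l)

/-- On invariants the middle term vanishes and both number operators equal `c`, leaving `2c² + 2c`.
-/
lemma sum_Fdag_mul_Fann : ∑ k, ∑ l, Fdag e k l * Fann e k l =
    2 * (numTot e 0 * numTot e 1) - 2 * ((∑ i, Jp e i) * ∑ i, Jm e i) + 2 * numTot e 0 := by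
  have h1 : ∑ k, ∑ l, cre (e (k, 0)) * ann (e (k, 0)) * (cre (e (l, 1)) * ann (e (l, 1))) =
      numTot e 0 * numTot e 1 := by
    rw [numTot, numTot, Finset.sum_mul_sum]
  have h2 : ∑ k, ∑ l, cre (e (l, 0)) * ann (e (l, 0)) * (cre (e (k, 1)) * ann (e (k, 1))) =
      numTot e 0 * numTot e 1 := by
    rw [Finset.sum_comm, h1]
  have h3 : ∑ k, ∑ l, Jp e k * Jm e l = (∑ i, Jp e i) * ∑ i, Jm e i := by
    rw [Finset.sum_mul_sum]
  have h4 : ∑ k, ∑ l, Jp e l * Jm e k = (∑ i, Jp e i) * ∑ i, Jm e i := by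
    rw [Finset.sum_comm, h3]
  simp only [Fdag_mul_Fann_self he, Finset.sum_add_distrib, Finset.sum_sub_distrib, h1, h2, h3, h4,
    Finset.sum_ite_eq, Finset.mem_univ, if_true]
  rw [← Finset.mul_sum, ← numTot]
  noncomm_ring

lemma sum_Fdag_Fann_apply {ψ : Amp M} (hψ : ψ ∈ su2Invariants e) {c : ℂ}
    (hc : numTot e 0 ψ = c • ψ) :
    ∑ k, ∑ l, Fdag e k l (Fann e k l ψ) = (2 * c * (c + 1)) • ψ := by
  have h := congrArg (fun T : Module.End ℂ (Amp M) => T ψ) (sum_Fdag_mul_Fann he)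
  simp only [two_mul, LinearMap.sum_apply, Module.End.mul_apply, LinearMap.add_apply,
    LinearMap.sub_apply] at h
  simp only [← LinearMap.sum_apply] at h
  rw [(mem_su2Invariants_iff.1 hψ).2.2, numTot_one_apply hψ, hc] at h
  simp only [LinearMap.sum_apply] at h
  rw [h, map_smul, hc]
  simp only [map_zero, Finset.sum_const_zero]
  module

lemma sum_Fann_mul_Fdag : ∑ m, ∑ n, Fann e m n * Fdag e m n =
    ∑ m, ∑ n, Fdag e m n * Fann e m n
      + (2 * N - 2 : ℂ) • (numTot e 0 + numTot e 1) + (2 * N ^ 2 - 2 * N : ℂ) • 1 := by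
  simp only [Fann_mul_Fdag_self he, Finset.sum_add_distrib, Finset.sum_sub_distrib,
    Finset.sum_ite_eq, Finset.mem_univ, if_true, ← Finset.mul_sum, Finset.sum_const,
    Finset.card_univ, Fintype.card_fin, ← sum_E_eq, ← Finset.smul_sum]
  rw [← one_add_one_eq_two (R := Module.End ℂ (Amp M)), add_mul, one_mul]
  module

lemma sum_Fann_Fdag_apply {ψ : Amp M} (hψ : ψ ∈ su2Invariants e) {c : ℂ}
    (hc : numTot e 0 ψ = c • ψ) :
    ∑ k, ∑ l, Fann e k l (Fdag e k l ψ) = (2 * (c + N) * (c + N - 1)) • ψ := by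
  have h := congrArg (fun T : Module.End ℂ (Amp M) => T ψ) (sum_Fann_mul_Fdag he)
  simp only [LinearMap.sum_apply, Module.End.mul_apply, LinearMap.add_apply,
    LinearMap.smul_apply, Module.End.one_apply] at h
  rw [h, sum_Fdag_Fann_apply he hψ hc, numTot_one_apply hψ, hc]
  module

lemma numTot_zero_Fann_apply (k l : Fin N) {ψ : Amp M} {c : ℂ} (hc : numTot e 0 ψ = c • ψ) :
    numTot e 0 (Fann e k l ψ) = (c - 1) • Fann e k l ψ := by
  rw [← Module.End.mul_apply, numTot_zero_mul_Fann he, LinearMap.sub_apply, Module.End.mul_apply,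
    hc, map_smul]
  module

/-- On `SU(2)`-invariant states with `∑ a†a = c`, the sum `∑ F†_kl F_mn F†_mn F_kl` is a scalar. -/
lemma sum_Fdag_Fann_Fdag_Fann_apply {ψ : Amp M} (hψ : ψ ∈ su2Invariants e) {c : ℂ}
    (hc : numTot e 0 ψ = c • ψ) :
    ∑ k, ∑ l, ∑ m, ∑ n, Fdag e k l (Fann e m n (Fdag e m n (Fann e k l ψ))) =
      (4 * c * (c + 1) * (c + N - 1) * (c + N - 2)) • ψ := by
  have h : ∀ k l, ∑ m, ∑ n, Fdag e k l (Fann e m n (Fdag e m n (Fann e k l ψ))) =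
      (2 * (c + N - 1) * (c + N - 2)) • Fdag e k l (Fann e k l ψ) := fun k l => by
    simp only [← map_sum]
    -- The inner contraction acts on `F_kl ψ`, again invariant but with `c - 1` in place of `c`.
    rw [sum_Fann_Fdag_apply he (Fann_mem_su2Invariants he k l hψ)
      (numTot_zero_Fann_apply he k l hc), map_smul]
    congr 1; ring
  simp only [h, ← Finset.smul_sum]
  rw [sum_Fdag_Fann_apply he hψ hc, smul_smul]
  congr 1; ring

end Casimir

/-! ### The constraint algebra and the action of `f†f` on solutions -/

section Solutions

variable {N : ℕ}

lemma L_injective : Function.Injective (L N) := Sum.inl_injective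

lemma R_injective : Function.Injective (R N) := Sum.inr_injective

lemma L_ne_R (x y : Mode N) : L N x ≠ R N y := Sum.inl_ne_inr

lemma commute_LR {A B : Module.End ℂ (Amp (Mode4 N))} (hA : A ∈ oscAlg (L N))
    (hB : B ∈ oscAlg (R N)) : Commute A B :=
  commute_of_mem_oscAlg L_ne_R hA hB

/-- Transposition reverses the `u(N)` bracket and the minus sign reverses it back, so `-E^R_ji` is
again a representation, commuting with the left one. -/
lemma C_bracket (i j k l : Fin N) :
    (⁅C i j, C k l⁆ : Module.End ℂ (Amp (Mode4 N))) =
        (if j = k then C i l else 0) - (if i = l then C k j else 0) := by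
  have h1 := E_bracket (L_injective (N := N)) i j k l
  have h2 := E_bracket (R_injective (N := N)) j i l k
  have h3 := (commute_LR (E_mem_oscAlg (L N) i j) (E_mem_oscAlg (R N) l k)).eq
  have h4 := (commute_LR (E_mem_oscAlg (L N) k l) (E_mem_oscAlg (R N) j i)).eq
  have h5 : ⁅C i j, C k l⁆ = (E (L N) i j * E (L N) k l - E (L N) k l * E (L N) i j)
      + (E (R N) j i * E (R N) l k - E (R N) l k * E (R N) j i) := by
    rw [Ring.lie_def, C, C, sub_mul, sub_mul, mul_sub, mul_sub, mul_sub, mul_sub, h3, h4]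
    abel
  rw [h5, h1, h2]
  simp only [C]
  split_ifs <;> abel

/-- `f = ∑_{kl} F^L_kl F^R_kl`. -/
def fann (N : ℕ) : Module.End ℂ (Amp (Mode4 N)) :=
  ∑ k : Fin N, ∑ l : Fin N, Fann (L N) k l * Fann (R N) k l

/-- `F^L` and `F^R` transform dually under `C`, so their full contraction is a `U(N)` scalar: the
left and right terms cancel once the Kronecker deltas are summed. -/
lemma C_commute_fann (i j : Fin N) : Commute (C i j) (fann N) := by
  have h : ∀ k l, C i j * (Fann (L N) k l * Fann (R N) k l) =
      Fann (L N) k l * Fann (R N) k l * C i j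
      - (if i = k then Fann (L N) j l * Fann (R N) i l else 0)
      - (if i = l then Fann (L N) k j * Fann (R N) k i else 0)
      + (if j = k then Fann (L N) j l * Fann (R N) i l else 0)
      + (if j = l then Fann (L N) k j * Fann (R N) k i else 0) := fun k l => by
    have h1 := E_bracket_Fann (L_injective (N := N)) i j k l
    have h2 := E_bracket_Fann (R_injective (N := N)) j i k l
    have h3 := (commute_LR (E_mem_oscAlg (L N) i j) (Fann_mem_oscAlg (R N) k l)).eq
    have h4 := (commute_LR (Fann_mem_oscAlg (L N) k l) (E_mem_oscAlg (R N) j i)).eq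
    rw [C, sub_mul, ← mul_assoc, h1, ← mul_assoc, ← h4, mul_assoc _ (E (R N) j i), h2, mul_sub,
      sub_mul, sub_mul, mul_assoc _ (E (L N) i j), h3]
    split_ifs <;> subst_vars <;> simp only [mul_sub, mul_assoc, zero_mul, mul_zero] <;> abel
  rw [Commute, SemiconjBy, fann]
  simp only [Finset.mul_sum, Finset.sum_mul, h, Finset.sum_add_distrib, Finset.sum_sub_distrib,
    Finset.sum_ite_eq, Finset.mem_univ, if_true]
  rw [Finset.sum_comm (f := fun k l => if i = k then _ else _),
    Finset.sum_comm (f := fun k l => if j = k then _ else _)]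
  simp only [Finset.sum_ite_eq, Finset.mem_univ, if_true]
  abel

lemma C_commute_fdag (i j : Fin N) : Commute (C i j) (fdag N) := by
  have h : ∀ k l, C i j * (Fdag (L N) k l * Fdag (R N) k l) =
      Fdag (L N) k l * Fdag (R N) k l * C i j
      + (if j = k then Fdag (L N) i l * Fdag (R N) j l else 0)
      + (if j = l then Fdag (L N) k i * Fdag (R N) k j else 0)
      - (if i = k then Fdag (L N) i l * Fdag (R N) j l else 0)
      - (if i = l then Fdag (L N) k i * Fdag (R N) k j else 0) := fun k l => by
    have h1 := sub_eq_iff_eq_add.1 (E_bracket_Fdag (L_injective (N := N)) i j k l)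
    have h2 := sub_eq_iff_eq_add.1 (E_bracket_Fdag (R_injective (N := N)) j i k l)
    have h3 := (commute_LR (E_mem_oscAlg (L N) i j) (Fdag_mem_oscAlg (R N) k l)).eq
    have h4 := (commute_LR (Fdag_mem_oscAlg (L N) k l) (E_mem_oscAlg (R N) j i)).eq
    rw [C, sub_mul, ← mul_assoc, h1, ← mul_assoc, ← h4, mul_assoc _ (E (R N) j i), h2, mul_sub,
      add_mul, mul_assoc _ (E (L N) i j), h3]
    split_ifs <;> subst_vars <;> simp only [add_mul, mul_add, mul_assoc, zero_mul,
      mul_zero] <;> abel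
  rw [Commute, SemiconjBy, fdag]
  simp only [Finset.mul_sum, Finset.sum_mul, h, Finset.sum_add_distrib, Finset.sum_sub_distrib,
    Finset.sum_ite_eq, Finset.mem_univ, if_true]
  rw [Finset.sum_comm (f := fun k l => if i = k then _ else _),
    Finset.sum_comm (f := fun k l => if j = k then _ else _)]
  simp only [Finset.sum_ite_eq, Finset.mem_univ, if_true]
  abel

/-- Coefficient families solving the intertwiner conditions and all the constraints. -/
def solutions (N : ℕ) : Submodule ℂ (Amp (Mode4 N)) :=
  su2Invariants (L N) ⊓ su2Invariants (R N) ⊓ ⨅ i : Fin N, ⨅ j : Fin N, LinearMap.ker (C i j)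

lemma mem_solutions_iff {ψ : Amp (Mode4 N)} : ψ ∈ solutions N ↔
    ψ ∈ su2Invariants (L N) ∧ ψ ∈ su2Invariants (R N) ∧ ∀ i j : Fin N, C i j ψ = 0 := by
  simp only [solutions, Submodule.mem_inf, Submodule.mem_iInf, LinearMap.mem_ker, and_assoc]

lemma HC_eq_comap : HC N = (solutions N).comap (amp (Mode4 N)) := rfl

lemma E_L_apply {ψ : Amp (Mode4 N)} (hψ : ψ ∈ solutions N) (i j : Fin N) :
    E (L N) i j ψ = E (R N) j i ψ := by
  have h := (mem_solutions_iff.1 hψ).2.2 i j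
  rwa [C, LinearMap.sub_apply, sub_eq_zero] at h

lemma fann_mem_solutions {ψ : Amp (Mode4 N)} (hψ : ψ ∈ solutions N) : fann N ψ ∈ solutions N := by
  obtain ⟨hL, hR, hC⟩ := mem_solutions_iff.1 hψ
  refine mem_solutions_iff.2 ⟨?_, ?_, fun i j => ?_⟩
  · simp only [fann, LinearMap.sum_apply]
    refine sum_mem fun k _ => sum_mem fun l _ => ?_
    rw [(commute_LR (Fann_mem_oscAlg _ k l) (Fann_mem_oscAlg _ k l)).eq]
    exact apply_mem_su2Invariants (Fann_mem_su2Invariants L_injective k l hL)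
      (commute_LR (sum_mem fun i _ => Jz_mem_oscAlg _ i) (Fann_mem_oscAlg _ k l))
      (commute_LR (sum_mem fun i _ => Jp_mem_oscAlg _ i) (Fann_mem_oscAlg _ k l))
      (commute_LR (sum_mem fun i _ => Jm_mem_oscAlg _ i) (Fann_mem_oscAlg _ k l))
  · simp only [fann, LinearMap.sum_apply]
    refine sum_mem fun k _ => sum_mem fun l _ => ?_
    exact apply_mem_su2Invariants (Fann_mem_su2Invariants R_injective k l hR)
      (commute_LR (Fann_mem_oscAlg _ k l) (sum_mem fun i _ => Jz_mem_oscAlg _ i)).symm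
      (commute_LR (Fann_mem_oscAlg _ k l) (sum_mem fun i _ => Jp_mem_oscAlg _ i)).symm
      (commute_LR (Fann_mem_oscAlg _ k l) (sum_mem fun i _ => Jm_mem_oscAlg _ i)).symm
  · rw [← Module.End.mul_apply, (C_commute_fann i j).eq, Module.End.mul_apply, hC, map_zero]

lemma fdag_mem_solutions {ψ : Amp (Mode4 N)} (hψ : ψ ∈ solutions N) : fdag N ψ ∈ solutions N := by
  obtain ⟨hL, hR, hC⟩ := mem_solutions_iff.1 hψ
  refine mem_solutions_iff.2 ⟨?_, ?_, fun i j => ?_⟩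
  · simp only [fdag, LinearMap.sum_apply]
    refine sum_mem fun k _ => sum_mem fun l _ => ?_
    rw [(commute_LR (Fdag_mem_oscAlg _ k l) (Fdag_mem_oscAlg _ k l)).eq]
    exact apply_mem_su2Invariants (Fdag_mem_su2Invariants L_injective k l hL)
      (commute_LR (sum_mem fun i _ => Jz_mem_oscAlg _ i) (Fdag_mem_oscAlg _ k l))
      (commute_LR (sum_mem fun i _ => Jp_mem_oscAlg _ i) (Fdag_mem_oscAlg _ k l))
      (commute_LR (sum_mem fun i _ => Jm_mem_oscAlg _ i) (Fdag_mem_oscAlg _ k l))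
  · simp only [fdag, LinearMap.sum_apply]
    refine sum_mem fun k _ => sum_mem fun l _ => ?_
    exact apply_mem_su2Invariants (Fdag_mem_su2Invariants R_injective k l hR)
      (commute_LR (Fdag_mem_oscAlg _ k l) (sum_mem fun i _ => Jz_mem_oscAlg _ i)).symm
      (commute_LR (Fdag_mem_oscAlg _ k l) (sum_mem fun i _ => Jp_mem_oscAlg _ i)).symm
      (commute_LR (Fdag_mem_oscAlg _ k l) (sum_mem fun i _ => Jm_mem_oscAlg _ i)).symm
  · rw [← Module.End.mul_apply, (C_commute_fdag i j).eq, Module.End.mul_apply, hC, map_zero]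

/-- On solutions, a `U(N)`-covariant right bilinear acts as the transposed left one. -/
lemma Fdag_Fann_R_apply {ψ : Amp (Mode4 N)} (hψ : ψ ∈ solutions N) (k l m n : Fin N) :
    Fdag (R N) k l (Fann (R N) m n ψ) = Fdag (L N) m n (Fann (L N) k l ψ) := by
  -- Only the operator next to `ψ` can be traded for a left one; it then commutes past the remaining
  -- right operator, so the order of the two is reversed.
  have hEE : ∀ a b c d, E (R N) a b (E (R N) c d ψ) = E (L N) d c (E (L N) b a ψ) := by
    intro a b c d
    rw [← E_L_apply hψ d c, ← Module.End.mul_apply,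
      ← (commute_LR (E_mem_oscAlg _ d c) (E_mem_oscAlg _ a b)).eq, Module.End.mul_apply,
      E_L_apply hψ b a]
  -- Of the two quadratic terms only one emerges in the wrong order; this bracket restores it, and
  -- its deltas match the linear terms.
  have hbr := congrArg (fun T : Module.End ℂ _ => T ψ) (E_bracket (L_injective (N := N)) n l m k)
  rw [← Module.End.mul_apply, ← Module.End.mul_apply, Fdag_mul_Fann R_injective,
    Fdag_mul_Fann L_injective]
  simp only [LinearMap.sub_apply, LinearMap.add_apply, Module.End.mul_apply, hEE] at hbr ⊢
  rw [sub_eq_iff_eq_add] at hbr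
  rw [hbr]
  have h1 := E_L_apply hψ n k
  have h2 := E_L_apply hψ m k
  simp only [eq_comm (a := k), eq_comm (a := l)]
  split_ifs <;> simp only [LinearMap.zero_apply, ← h1, ← h2] <;> abel

/-- In `∑ F†L_kl F†R_kl FL_mn FR_mn ψ` the two middle factors commute, and `F†R_kl FR_mn ψ = F†L_mn
FL_kl ψ`. What remains is the left contraction already known to be a scalar. -/
lemma fdag_fann_apply {ψ : Amp (Mode4 N)} (hψ : ψ ∈ solutions N) {c : ℂ}
    (hc : numTot (L N) 0 ψ = c • ψ) :
    fdag N (fann N ψ) = (4 * c * (c + 1) * (c + N - 1) * (c + N - 2)) • ψ := by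
  rw [← sum_Fdag_Fann_Fdag_Fann_apply L_injective (mem_solutions_iff.1 hψ).1 hc]
  simp only [fdag, LinearMap.sum_apply]
  refine Finset.sum_congr rfl fun k _ => Finset.sum_congr rfl fun l _ => ?_
  simp only [fann, LinearMap.sum_apply, map_sum]
  refine Finset.sum_congr rfl fun m _ => Finset.sum_congr rfl fun n _ => ?_
  rw [← Fdag_Fann_R_apply hψ k l m n]
  simp only [Module.End.mul_apply]
  congr 1
  exact LinearMap.congr_fun
    (commute_LR (Fann_mem_oscAlg _ m n) (Fdag_mem_oscAlg _ k l)).eq.symm (Fann (R N) m n ψ)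

lemma numTot_L_commute_fdag : numTot (L N) 0 * fdag N = fdag N * numTot (L N) 0 + fdag N := by
  simp only [fdag, Finset.mul_sum, Finset.sum_mul, ← Finset.sum_add_distrib]
  refine Finset.sum_congr rfl fun k _ => Finset.sum_congr rfl fun l _ => ?_
  rw [← mul_assoc, numTot_zero_mul_Fdag L_injective, add_mul, mul_assoc, mul_assoc,
    (commute_LR (numTot_mem_oscAlg _ 0) (Fdag_mem_oscAlg _ k l)).eq]

lemma numTot_L_commute_fann : numTot (L N) 0 * fann N = fann N * numTot (L N) 0 - fann N := by
  simp only [fann, Finset.mul_sum, Finset.sum_mul, ← Finset.sum_sub_distrib]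
  refine Finset.sum_congr rfl fun k _ => Finset.sum_congr rfl fun l _ => ?_
  rw [← mul_assoc, numTot_zero_mul_Fann L_injective, sub_mul, mul_assoc, mul_assoc,
    (commute_LR (numTot_mem_oscAlg _ 0) (Fann_mem_oscAlg _ k l)).eq]

end Solutions

/-! ### Area levels: uniqueness and nonvanishing of `|J⟩` -/

section Levels

variable {M : Type} [DecidableEq M] {N : ℕ}

lemma numTot_apply (e : Mode N → M) (s : Fin 2) (ψ : Amp M) (n : M → ℕ) :
    numTot e s ψ n = ((∑ i, n (e (i, s)) : ℕ) : ℂ) * ψ n := by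
  rw [numTot, LinearMap.sum_apply, Finset.sum_apply]
  simp only [cre_mul_ann_self_apply, ← Finset.sum_mul]
  push_cast; rfl

lemma E_self_apply (e : Mode N → M) (i : Fin N) (ψ : Amp M) (n : M → ℕ) :
    E e i i ψ n = ((n (e (i, 0)) + n (e (i, 1)) : ℕ) : ℂ) * ψ n := by
  rw [E, LinearMap.add_apply, Pi.add_apply, cre_mul_ann_self_apply, cre_mul_ann_self_apply]
  push_cast; ring

lemma ann_vac (x : M) : ann x (vac M) = 0 := by
  funext n
  have h : n + Pi.single x 1 ≠ 0 := fun h => by simpa using congrFun h x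
  simp [ann_apply, vac, h]

lemma Jm_eq {e : Mode N → M} (he : Function.Injective e) (i : Fin N) :
    Jm e i = cre (e (i, 1)) * ann (e (i, 0)) := by
  rw [Jm, ann_mul_cre, if_neg (by simp [he.eq_iff]), add_zero]

lemma E_vac (e : Mode N → M) (i j : Fin N) : E e i j (vac M) = 0 := by
  simp [E, ann_vac]

lemma vac_mem_su2Invariants {e : Mode N → M} (he : Function.Injective e) :
    vac M ∈ su2Invariants e := by
  refine mem_su2Invariants_iff.2 ⟨?_, ?_, ?_⟩
  · simp [Jz, ann_vac]
  · simp [Jp, ann_vac]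
  · simp [Jm_eq he, ann_vac]

lemma vac_mem_solutions : vac (Mode4 N) ∈ solutions N :=
  mem_solutions_iff.2 ⟨vac_mem_su2Invariants L_injective, vac_mem_su2Invariants R_injective,
    fun i j => by simp [C, E_vac]⟩

lemma ketAmp_zero : ketAmp N 0 = vac (Mode4 N) := rfl

lemma ketAmp_succ (J : ℕ) : ketAmp N (J + 1) = fdag N (ketAmp N J) := by
  rw [ketAmp, pow_succ', Module.End.mul_apply, ketAmp]

lemma ketAmp_mem_solutions (J : ℕ) : ketAmp N J ∈ solutions N := by
  induction J with
  | zero => exact vac_mem_solutions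
  | succ J ih => rw [ketAmp_succ]; exact fdag_mem_solutions ih

lemma numTot_ketAmp (J : ℕ) : numTot (L N) 0 (ketAmp N J) = (J : ℂ) • ketAmp N J := by
  induction J with
  | zero => simp [ketAmp_zero, numTot, ann_vac]
  | succ J ih =>
    rw [ketAmp_succ, ← Module.End.mul_apply, numTot_L_commute_fdag, LinearMap.add_apply,
      Module.End.mul_apply, ih, map_smul]
    push_cast
    module

/-- The trace of the constraints equates the left and right totals, and `J^z = 0` makes each total
twice the number of `a` quanta. -/
lemma numTot_R_apply {ψ : Amp (Mode4 N)} (hψ : ψ ∈ solutions N) :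
    numTot (R N) 0 ψ = numTot (L N) 0 ψ := by
  obtain ⟨hL, hR, -⟩ := mem_solutions_iff.1 hψ
  have h : (∑ i, E (L N) i i) ψ = (∑ i, E (R N) i i) ψ := by
    rw [LinearMap.sum_apply, LinearMap.sum_apply]
    exact Finset.sum_congr rfl fun i _ => E_L_apply hψ i i
  rw [sum_E_eq, sum_E_eq, LinearMap.add_apply, LinearMap.add_apply, numTot_one_apply hL,
    numTot_one_apply hR, ← two_smul ℂ, ← two_smul ℂ (numTot (R N) 0 ψ)] at h
  exact (smul_right_injective _ (two_ne_zero : (2 : ℂ) ≠ 0) h).symm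

/-- On the support of a solution the four partial occupation numbers coincide. -/
lemma occupation_eq {ψ : Amp (Mode4 N)} (hψ : ψ ∈ solutions N) {n : Mode4 N → ℕ} (hn : ψ n ≠ 0) :
    ∑ i, n (L N (i, 1)) = ∑ i, n (L N (i, 0)) ∧ ∑ i, n (R N (i, 0)) = ∑ i, n (L N (i, 0)) ∧
      ∑ i, n (R N (i, 1)) = ∑ i, n (L N (i, 0)) := by
  obtain ⟨hL, hR, -⟩ := mem_solutions_iff.1 hψ
  have h1 := congrFun (numTot_one_apply hL) n
  have h2 := congrFun (numTot_one_apply hR) n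
  have h3 := congrFun (numTot_R_apply hψ) n
  rw [numTot_apply, numTot_apply] at h1 h2 h3
  have h1 := Nat.cast_injective (mul_right_cancel₀ hn h1)
  have h2 := Nat.cast_injective (mul_right_cancel₀ hn h2)
  have h3 := Nat.cast_injective (mul_right_cancel₀ hn h3)
  exact ⟨h1, h3, h2.trans h3⟩

lemma occupation_of_numTot {ψ : Amp (Mode4 N)} {J : ℕ} (hJ : numTot (L N) 0 ψ = (J : ℂ) • ψ)
    {n : Mode4 N → ℕ} (hn : ψ n ≠ 0) : ∑ i, n (L N (i, 0)) = J := by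
  have h := congrFun hJ n
  rw [numTot_apply] at h
  exact Nat.cast_injective (mul_right_cancel₀ hn h)

/-- Base of the induction on area: all four partial occupation totals coincide, hence all vanish. -/
lemma eq_smul_vac {ψ : Amp (Mode4 N)} (hψ : ψ ∈ solutions N) (h0 : numTot (L N) 0 ψ = 0) :
    ψ = ψ 0 • vac (Mode4 N) := by
  funext n
  by_cases hn : n = 0
  · subst hn; simp [vac]
  · have hv : vac (Mode4 N) n = 0 := by simp [vac, hn]
    rw [Pi.smul_apply, hv, smul_zero]
    by_contra hne
    obtain ⟨h1, h2, h3⟩ := occupation_eq hψ hne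
    have h4 : ∑ i, n (L N (i, 0)) = 0 :=
      occupation_of_numTot (J := 0) (by rw [h0, Nat.cast_zero, zero_smul]) hne
    rw [h4] at h1 h2 h3
    simp only [Finset.sum_eq_zero_iff, Finset.mem_univ, true_implies] at h1 h2 h3 h4
    refine hn (funext fun x => ?_)
    rcases x with ⟨i, s⟩ | ⟨i, s⟩ <;> fin_cases s
    · exact h4 i
    · exact h1 i
    · exact h2 i
    · exact h3 i

/-- The solutions of given area form a line. -/
theorem exists_smul_ketAmp (hN : 2 ≤ N) (J : ℕ) {ψ : Amp (Mode4 N)} (hψ : ψ ∈ solutions N)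
    (hJ : numTot (L N) 0 ψ = (J : ℂ) • ψ) : ∃ c : ℂ, ψ = c • ketAmp N J := by
  induction J generalizing ψ with
  | zero => exact ⟨ψ 0, eq_smul_vac hψ (by rw [hJ, Nat.cast_zero, zero_smul])⟩
  | succ J ih =>
    have h := fdag_fann_apply hψ hJ
    obtain ⟨c, hc⟩ := ih (fann_mem_solutions hψ) (by
      rw [← Module.End.mul_apply, numTot_L_commute_fann, LinearMap.sub_apply,
        Module.End.mul_apply, hJ, map_smul]
      push_cast
      module)
    rw [hc, map_smul, ← ketAmp_succ] at h
    set a : ℂ := 4 * ((J + 1 : ℕ) : ℂ) * ((J + 1 : ℕ) + 1) * ((J + 1 : ℕ) + N - 1) *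
      ((J + 1 : ℕ) + N - 2) with ha
    have ha0 : a ≠ 0 := by
      -- Writing `N = 2 + m` turns every factor into a positive natural number; the last one, `J + m
      -- + 1`, is where `N ≥ 2` matters.
      obtain ⟨m, rfl⟩ := Nat.exists_eq_add_of_le hN
      have : a = ((4 * (J + 1) * (J + 2) * (J + m + 2) * (J + m + 1) : ℕ) : ℂ) := by
        rw [ha]; push_cast; ring
      rw [this, Nat.cast_ne_zero]
      positivity
    -- `a ψ = f†f ψ` and `f ψ = c |J⟩` give `a ψ = c |J+1⟩`.
    refine ⟨a⁻¹ * c, ?_⟩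
    rw [mul_smul, h, smul_smul, inv_mul_cancel₀ ha0, one_smul]

/-- `Fdag` evaluated at an occupation number with only `a_{i₀}` and `b_{i₁}` excited. -/
lemma Fdag_apply_of_extremal {e : Mode N → M} (he : Function.Injective e) {i₀ i₁ : Fin N}
    {n : M → ℕ} {J : ℕ} (h0 : ∀ i, n (e (i, 0)) = if i = i₀ then J else 0)
    (h1 : ∀ i, n (e (i, 1)) = if i = i₁ then J else 0) (k l : Fin N) (χ : Amp M) :
    Fdag e k l χ n = ((if k = i₀ ∧ l = i₁ then 1 else 0) - (if k = i₁ ∧ l = i₀ then 1 else 0)) *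
      (J * χ (n - Pi.single (e (i₀, 0)) 1 - Pi.single (e (i₁, 1)) 1)) := by
  have h : ∀ k l, (cre (e (k, 0)) * cre (e (l, 1)) : Module.End ℂ (Amp M)) χ n =
      (if k = i₀ ∧ l = i₁ then 1 else 0) *
      (J * χ (n - Pi.single (e (i₀, 0)) 1 - Pi.single (e (i₁, 1)) 1)) := fun k l => by
    have hne : e (l, 1) ≠ e (k, 0) := by simp [he.eq_iff]
    rw [Module.End.mul_apply, cre_apply, cre_apply, h0, Pi.sub_apply, Pi.single_eq_of_ne hne,
      Nat.sub_zero, h1]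
    by_cases hk : k = i₀
    · by_cases hl : l = i₁
      · subst hk hl
        simp [← mul_assoc, sqrt_mul_sqrt_nat]
      · simp [hl]
    · simp [hk]
  rw [Fdag, LinearMap.sub_apply, Pi.sub_apply, h, h, sub_mul]
  simp only [and_comm]

/-- The occupation number with `J` quanta in each of `a_{i₀}`, `b_{i₁}` of both copies. -/
def extremal (i₀ i₁ : Fin N) (J : ℕ) : Mode4 N → ℕ :=
  Sum.elim (fun x => if x = (i₀, 0) ∨ x = (i₁, 1) then J else 0)
    (fun x => if x = (i₀, 0) ∨ x = (i₁, 1) then J else 0)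

/-- At this occupation number only `(k, l) = (i₀, i₁)` and `(i₁, i₀)` contribute to `f†`. The sign
of `F†` under exchange squares away between the two copies, so the step to `J + 1` multiplies the
coefficient by `2 (J+1)²`. -/
lemma ketAmp_extremal {i₀ i₁ : Fin N} (h : i₀ ≠ i₁) (J : ℕ) :
    ketAmp N J (extremal i₀ i₁ J) = 2 ^ J * (J.factorial : ℂ) ^ 2 := by
  induction J with
  | zero =>
    have : extremal i₀ i₁ 0 = 0 := by
      funext x; rcases x with x | x <;> simp [extremal]
    rw [this]
    simp [ketAmp_zero, vac]
  | succ J ih =>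
    have hlow : extremal i₀ i₁ (J + 1) - Pi.single (L N (i₀, 0)) 1 - Pi.single (L N (i₁, 1)) 1
        - Pi.single (R N (i₀, 0)) 1 - Pi.single (R N (i₁, 1)) 1 = extremal i₀ i₁ J := by
      funext x
      rcases x with ⟨i, s⟩ | ⟨i, s⟩ <;> fin_cases s <;>
        simp only [extremal, Pi.sub_apply, Pi.single_apply, Sum.elim_inl, Sum.elim_inr,
          Sum.inl.injEq, Sum.inr.injEq, reduceCtorEq, Prod.mk.injEq, if_false] <;>
        by_cases hi : i = i₀ <;> by_cases hi' : i = i₁ <;> simp [hi, hi', h, h.symm]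
    have hterm : ∀ k l, (Fdag (L N) k l * Fdag (R N) k l) (ketAmp N J) (extremal i₀ i₁ (J + 1)) =
        ((if k = i₀ ∧ l = i₁ then 1 else 0) + (if k = i₁ ∧ l = i₀ then 1 else 0)) *
          (((J + 1 : ℕ) : ℂ) ^ 2 * ketAmp N J (extremal i₀ i₁ J)) := fun k l => by
      rw [Module.End.mul_apply, Fdag_apply_of_extremal L_injective (J := J + 1) (i₀ := i₀)
        (i₁ := i₁) (by simp [extremal]) (by simp [extremal]),
        Fdag_apply_of_extremal R_injective (J := J + 1) (i₀ := i₀)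
        (i₁ := i₁) (by simp [extremal]) (by simp [extremal]), hlow]
      by_cases h1 : k = i₀ ∧ l = i₁
      · have h2 : ¬ (k = i₁ ∧ l = i₀) := fun h2 => h (h1.1.symm.trans h2.1)
        rw [if_pos h1, if_neg h2]; ring
      · rw [if_neg h1]; split_ifs <;> ring
    rw [ketAmp_succ, fdag, LinearMap.sum_apply, Finset.sum_apply]
    simp only [LinearMap.sum_apply, Finset.sum_apply, hterm, ← Finset.sum_mul,
      Finset.sum_add_distrib, ite_and, Finset.sum_ite_eq', Finset.sum_ite_irrel,
      Finset.sum_const_zero, Finset.mem_univ, if_true]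
    rw [ih, Nat.factorial_succ]
    push_cast; ring

lemma ketAmp_ne_zero (hN : 2 ≤ N) (J : ℕ) : ketAmp N J ≠ 0 := by
  intro h
  have h1 := ketAmp_extremal (N := N) (i₀ := ⟨0, by omega⟩) (i₁ := ⟨1, by omega⟩)
    (by simp) J
  rw [h, Pi.zero_apply] at h1
  have : (2 : ℂ) ^ J * (J.factorial : ℂ) ^ 2 ≠ 0 :=
    mul_ne_zero (pow_ne_zero _ two_ne_zero)
      (pow_ne_zero _ (Nat.cast_ne_zero.2 J.factorial_ne_zero))
  exact this h1.symm

/-- Multiplication by a function of the occupation numbers. -/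
def diagOp (g : (M → ℕ) → ℂ) : Module.End ℂ (Amp M) where
  toFun ψ := fun n => g n * ψ n
  map_add' φ ψ := by funext n; simp [mul_add]
  map_smul' c ψ := by funext n; simp [mul_left_comm]

omit [DecidableEq M] in
lemma diagOp_apply (g : (M → ℕ) → ℂ) (ψ : Amp M) (n : M → ℕ) : diagOp g ψ n = g n * ψ n := rfl

/-- `a_x† a_y` moves one quantum between `x` and `y`, so it commutes with any function of the
occupations insensitive to such moves. -/
lemma diagOp_commute {g : (M → ℕ) → ℂ} {x y : M}
    (h : ∀ n : M → ℕ, n x ≠ 0 → g (n - Pi.single x 1 + Pi.single y 1) = g n) :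
    Commute (diagOp g) (cre x * ann y) := by
  refine LinearMap.ext fun ψ => funext fun n => ?_
  simp only [Module.End.mul_apply, diagOp_apply, cre_apply, ann_apply]
  by_cases hx : n x = 0
  · simp [hx]
  · rw [h n hx]; ring

/-- The projection to states with `2J` quanta in the left copy. -/
def levelProj (N J : ℕ) : Module.End ℂ (Amp (Mode4 N)) :=
  diagOp fun n => if ∑ x, n (L N x) = 2 * J then 1 else 0

lemma levelProj_commute_L (J : ℕ) (x y : Mode N) :
    Commute (levelProj N J) (cre (L N x) * ann (L N y)) := by
  refine diagOp_commute fun n hn => ?_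
  have h : ∀ (m : Mode4 N → ℕ) (z : Mode N),
      ∑ w, (m + Pi.single (L N z) 1 : Mode4 N → ℕ) (L N w) = ∑ w, m (L N w) + 1 := fun m z => by
    simp [Finset.sum_add_distrib, Pi.single_apply]
  have h1 := h (n - Pi.single (L N x) 1) x
  rw [sub_single_add_single hn] at h1
  rw [h, ← h1]

lemma levelProj_commute_R (J : ℕ) (x y : Mode N) :
    Commute (levelProj N J) (cre (R N x) * ann (R N y)) := by
  refine diagOp_commute fun n hn => ?_
  have h : ∀ (w z : Mode N), (Pi.single (R N z) 1 : Mode4 N → ℕ) (L N w) = 0 := fun w z => by simp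
  simp only [Pi.add_apply, Pi.sub_apply, h, Nat.sub_zero, add_zero]

lemma levelProj_commute_sums (J : ℕ) {e : Mode N → Mode4 N} (he : Function.Injective e)
    (h : ∀ x y, Commute (levelProj N J) (cre (e x) * ann (e y))) :
    (∀ i j, Commute (levelProj N J) (E e i j)) ∧ Commute (levelProj N J) (∑ i, Jz e i) ∧
      Commute (levelProj N J) (∑ i, Jp e i) ∧ Commute (levelProj N J) (∑ i, Jm e i) := by
  refine ⟨fun i j => (h _ _).add_right (h _ _), ?_, ?_, ?_⟩
  · exact Commute.sum_right _ _ _ fun i _ => ((h _ _).sub_right (h _ _)).smul_right _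
  · exact Commute.sum_right _ _ _ fun i _ => h _ _
  · exact Commute.sum_right _ _ _ fun i _ => by rw [Jm_eq he]; exact h _ _

/-- Every defining condition conserves the number of left quanta, so solutions can be studied one
area at a time. -/
lemma levelProj_mem_solutions (J : ℕ) {ψ : Amp (Mode4 N)} (hψ : ψ ∈ solutions N) :
    levelProj N J ψ ∈ solutions N := by
  obtain ⟨hL, hR, hC⟩ := mem_solutions_iff.1 hψ
  obtain ⟨l1, l2, l3, l4⟩ := levelProj_commute_sums J L_injective (levelProj_commute_L J)
  obtain ⟨r1, r2, r3, r4⟩ := levelProj_commute_sums J R_injective (levelProj_commute_R J)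
  refine mem_solutions_iff.2 ⟨apply_mem_su2Invariants hL l2.symm l3.symm l4.symm,
    apply_mem_su2Invariants hR r2.symm r3.symm r4.symm, fun i j => ?_⟩
  have h : Commute (levelProj N J) (C i j) := (l1 i j).sub_right (r1 j i)
  rw [← Module.End.mul_apply, ← h.eq, Module.End.mul_apply, hC, map_zero]

lemma sum_L_eq (n : Mode4 N → ℕ) :
    ∑ x, n (L N x) = ∑ i, n (L N (i, 0)) + ∑ i, n (L N (i, 1)) := by
  rw [Fintype.sum_prod_type, ← Finset.sum_add_distrib]
  simp

lemma exists_levelProj_eq (hN : 2 ≤ N) {ψ : Amp (Mode4 N)} (hψ : ψ ∈ solutions N) (J : ℕ) :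
    ∃ c : ℂ, levelProj N J ψ = c • ketAmp N J := by
  have hs := levelProj_mem_solutions J hψ
  refine exists_smul_ketAmp hN J hs (funext fun n => ?_)
  rw [numTot_apply]
  by_cases hn : levelProj N J ψ n = 0
  · rw [Pi.smul_apply, hn, mul_zero, smul_zero]
  · have h1 := (occupation_eq hs hn).1
    have h2 : ∑ x, n (L N x) = 2 * J := by
      by_contra h
      exact hn (by rw [levelProj, diagOp_apply, if_neg h, zero_mul])
    rw [sum_L_eq, h1] at h2
    rw [show ∑ i, n (L N (i, 0)) = J by omega]
    rfl

/-- A solution agrees with a multiple of `|J⟩` at every occupation number. -/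
lemma solution_apply {ψ : Amp (Mode4 N)} (hψ : ψ ∈ solutions N) (n : Mode4 N → ℕ) :
    ψ n = levelProj N (∑ i, n (L N (i, 0))) ψ n := by
  by_cases hn : ψ n = 0
  · rw [levelProj, diagOp_apply, hn, mul_zero]
  · have h1 := (occupation_eq hψ hn).1
    rw [levelProj, diagOp_apply, if_pos (by rw [sum_L_eq, h1]; ring), one_mul]

end Levels

/-! ### Diagonal simplicity -/

section DiagonalSimplicity

variable {M : Type} [DecidableEq M] {N : ℕ}

lemma JJ_self_apply {e : Mode N → M} (he : Function.Injective e) (i : Fin N) (ψ : Amp M)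
    (n : M → ℕ) :
    JJ e i i ψ n = ((n (e (i, 0)) + n (e (i, 1)) : ℂ) / 2 * ((n (e (i, 0)) + n (e (i, 1))) / 2 + 1))
      * ψ n := by
  have h1 : Jp e i * Jm e i = (cre (e (i, 0)) * ann (e (i, 0))) * (cre (e (i, 1)) * ann (e (i, 1)))
      + cre (e (i, 0)) * ann (e (i, 0)) := by
    simp only [Jp, Jm, mul_assoc, ann_mul_cre_mul, ann_mul_cre, he.eq_iff, mul_add, Prod.mk.injEq,
      and_false, if_false, add_zero, zero_ne_one, if_true]
    rw [ann_mul_ann]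
  have h2 : Jm e i * Jp e i = (cre (e (i, 0)) * ann (e (i, 0))) * (cre (e (i, 1)) * ann (e (i, 1)))
      + cre (e (i, 1)) * ann (e (i, 1)) := by
    simp only [Jp, Jm, mul_assoc, ann_mul_cre_mul, he.eq_iff, mul_add, Prod.mk.injEq,
      and_false, if_false, add_zero, zero_ne_one, if_true]
    rw [cre_mul_cre_mul]
  have hz : ∀ χ : Amp M, Jz e i χ n = (1 / 2 : ℂ) * ((n (e (i, 0)) : ℂ) - n (e (i, 1))) * χ n := by
    intro χ
    rw [Jz, LinearMap.smul_apply, Pi.smul_apply, LinearMap.sub_apply, Pi.sub_apply,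
      cre_mul_ann_self_apply, cre_mul_ann_self_apply, smul_eq_mul]
    ring
  rw [JJ, h1, h2]
  simp only [LinearMap.add_apply, LinearMap.smul_apply, Pi.add_apply, Pi.smul_apply, smul_eq_mul,
    Module.End.mul_apply (Jz e i), hz,
    Module.End.mul_apply (cre (e (i, 0)) * ann (e (i, 0))), cre_mul_ann_self_apply]
  ring

/-- Both operators are diagonal in occupation numbers. With `k = 2j^L` and `l = 2j^R` the Casimirs
differ by `(k - l)(k + l + 2)/4`, whose second factor never vanishes. -/
lemma C_self_eq_zero_iff (i : Fin N) (ψ : Amp (Mode4 N)) :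
    C i i ψ = 0 ↔ JJ (L N) i i ψ = JJ (R N) i i ψ := by
  simp only [funext_iff]
  refine forall_congr' fun n => ?_
  rw [JJ_self_apply L_injective, JJ_self_apply R_injective, C, LinearMap.sub_apply, Pi.sub_apply,
    E_self_apply, E_self_apply, Pi.zero_apply, ← sub_mul, ← sub_eq_zero (b := _ * ψ n), ← sub_mul]
  set k := n (L N (i, 0)) + n (L N (i, 1)) with hk
  set l := n (R N (i, 0)) + n (R N (i, 1)) with hl
  have h : ((n (L N (i, 0)) + n (L N (i, 1)) : ℂ) / 2 * ((n (L N (i, 0)) + n (L N (i, 1))) / 2 + 1)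
      - (n (R N (i, 0)) + n (R N (i, 1)) : ℂ) / 2 * ((n (R N (i, 0)) + n (R N (i, 1))) / 2 + 1)) =
      ((k : ℂ) - l) * (((k + l + 2 : ℕ) : ℂ) / 4) := by
    rw [hk, hl]; push_cast; ring
  have h0 : (((k + l + 2 : ℕ) : ℂ) / 4) ≠ 0 :=
    div_ne_zero (Nat.cast_ne_zero.2 (by omega)) (by norm_num)
  rw [h, mul_right_comm]
  simp only [mul_eq_zero, h0, or_false]

end DiagonalSimplicity

/-! ### Adjoints against finitely supported states -/

section Adjoint

variable {M : Type} [DecidableEq M] {N : ℕ}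

lemma ann_mem_finAmp (x : M) {φ : Amp M} (h : φ ∈ finAmp M) : ann x φ ∈ finAmp M := by
  refine Set.Finite.subset (Set.Finite.image (fun n => n - Pi.single x 1) h) fun n hn => ?_
  have hn' : (Real.sqrt ((n x : ℝ) + 1) : ℂ) * φ (n + Pi.single x 1) ≠ 0 := hn
  exact ⟨n + Pi.single x 1, right_ne_zero_of_mul hn', add_tsub_cancel_right _ _⟩

omit [DecidableEq M] in
lemma summable_braket_of_mem {φ : Amp M} (hφ : φ ∈ finAmp M) (χ : Amp M) :
    Summable fun n => starRingEnd ℂ (φ n) * χ n :=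
  summable_of_hasFiniteSupport (hφ.subset fun n hn => by
    have := left_ne_zero_of_mul (Function.mem_support.1 hn)
    exact fun h => this (by rw [h, map_zero]))

omit [DecidableEq M] in
lemma braket_add_right {φ : Amp M} (hφ : φ ∈ finAmp M) (χ χ' : Amp M) :
    braket φ (χ + χ') = braket φ χ + braket φ χ' := by
  simp only [braket, Pi.add_apply, mul_add]
  exact (summable_braket_of_mem hφ χ).tsum_add (summable_braket_of_mem hφ χ')

omit [DecidableEq M] in
lemma braket_sub_right {φ : Amp M} (hφ : φ ∈ finAmp M) (χ χ' : Amp M) :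
    braket φ (χ - χ') = braket φ χ - braket φ χ' := by
  simp only [braket, Pi.sub_apply, mul_sub]
  exact (summable_braket_of_mem hφ χ).tsum_sub (summable_braket_of_mem hφ χ')

omit [DecidableEq M] in
lemma braket_add_left {φ φ' : Amp M} (hφ : φ ∈ finAmp M) (hφ' : φ' ∈ finAmp M) (χ : Amp M) :
    braket (φ + φ') χ = braket φ χ + braket φ' χ := by
  simp only [braket, Pi.add_apply, map_add, add_mul]
  exact (summable_braket_of_mem hφ χ).tsum_add (summable_braket_of_mem hφ' χ)

omit [DecidableEq M] in
lemma braket_sub_left {φ φ' : Amp M} (hφ : φ ∈ finAmp M) (hφ' : φ' ∈ finAmp M) (χ : Amp M) :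
    braket (φ - φ') χ = braket φ χ - braket φ' χ := by
  simp only [braket, Pi.sub_apply, map_sub, sub_mul]
  exact (summable_braket_of_mem hφ χ).tsum_sub (summable_braket_of_mem hφ' χ)

/-- Reindexing along the injective shift `n ↦ n + e_x` needs no summability: the shift misses only
`n x = 0`, where the creation coefficient is zero. -/
lemma braket_cre (x : M) (φ χ : Amp M) : braket φ (cre x χ) = braket (ann x φ) χ := by
  have hinj : Function.Injective fun n : M → ℕ => n + Pi.single x 1 := add_left_injective _
  rw [braket, ← hinj.tsum_eq]
  · refine tsum_congr fun n => ?_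
    rw [cre_apply, ann_apply, add_tsub_cancel_right, map_mul, Complex.conj_ofReal]
    simp only [Pi.add_apply, Pi.single_eq_same, Nat.cast_add, Nat.cast_one]
    ring
  · intro n hn
    have h : n x ≠ 0 := fun h => hn (by simp [cre_apply, h])
    exact ⟨n - Pi.single x 1, sub_single_add_single h⟩

lemma braket_ann (x : M) (φ χ : Amp M) : braket φ (ann x χ) = braket (cre x φ) χ := by
  have hinj : Function.Injective fun n : M → ℕ => n + Pi.single x 1 := add_left_injective _
  rw [braket, braket, ← hinj.tsum_eq (f := fun n => starRingEnd ℂ (cre x φ n) * χ n)]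
  · refine tsum_congr fun n => ?_
    rw [cre_apply, ann_apply, add_tsub_cancel_right, map_mul, Complex.conj_ofReal]
    simp only [Pi.add_apply, Pi.single_eq_same, Nat.cast_add, Nat.cast_one]
    ring
  · intro n hn
    have h : n x ≠ 0 := fun h => hn (by simp [cre_apply, h])
    exact ⟨n - Pi.single x 1, sub_single_add_single h⟩

lemma E_mem_finAmp (e : Mode N → M) (i j : Fin N) {φ : Amp M} (h : φ ∈ finAmp M) :
    E e i j φ ∈ finAmp M :=
  add_mem (cre_mem_finAmp _ (ann_mem_finAmp _ h)) (cre_mem_finAmp _ (ann_mem_finAmp _ h))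

lemma braket_E (e : Mode N → M) (i j : Fin N) {φ : Amp M} (hφ : φ ∈ finAmp M) (χ : Amp M) :
    braket φ (E e i j χ) = braket (E e j i φ) χ := by
  rw [E, E, LinearMap.add_apply, LinearMap.add_apply, braket_add_right hφ]
  simp only [Module.End.mul_apply]
  rw [braket_cre, braket_ann, braket_cre, braket_ann, braket_add_left
    (cre_mem_finAmp _ (ann_mem_finAmp _ hφ)) (cre_mem_finAmp _ (ann_mem_finAmp _ hφ))]

lemma braket_C (i j : Fin N) {φ : Amp (Mode4 N)} (hφ : φ ∈ finAmp (Mode4 N)) (χ : Amp (Mode4 N)) :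
    braket φ (C i j χ) = braket (C j i φ) χ := by
  rw [C, C, LinearMap.sub_apply, LinearMap.sub_apply, braket_sub_right hφ, braket_E _ _ _ hφ,
    braket_E _ _ _ hφ, braket_sub_left (E_mem_finAmp _ _ _ hφ) (E_mem_finAmp _ _ _ hφ)]

end Adjoint

/-! ### `U(N)` invariance and the constraints -/

section Invariance

variable {N : ℕ}

/-- Anti-Hermiticity, `conj α_ij = -α_ji`, turns the conjugate right action into minus the
transposed one. -/
lemma uGen_eq {α : Matrix (Fin N) (Fin N) ℂ} (hα : α.conjTranspose = -α) :
    uGen α = ∑ i, ∑ j, α i j • C i j := by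
  have h : ∀ i j, starRingEnd ℂ (α i j) = - α j i := fun i j => congrFun (congrFun hα j) i
  have h2 : ∑ i, ∑ j, starRingEnd ℂ (α i j) • E (R N) i j =
      ∑ i, ∑ j, starRingEnd ℂ (α j i) • E (R N) j i := Finset.sum_comm
  simp only [uGen, Finset.sum_add_distrib]
  rw [h2, ← Finset.sum_add_distrib]
  refine Finset.sum_congr rfl fun i _ => ?_
  rw [← Finset.sum_add_distrib]
  refine Finset.sum_congr rfl fun j _ => ?_
  rw [h j i, C]
  module

lemma uGen_real_smul (t : ℝ) (α : Matrix (Fin N) (Fin N) ℂ) :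
    uGen ((t : ℂ) • α) = (t : ℂ) • uGen α := by
  simp only [uGen, Finset.smul_sum, smul_add, smul_smul, Matrix.smul_apply, smul_eq_mul, map_mul,
    Complex.conj_ofReal]

/-- A power series in a real variable that is constant has vanishing linear coefficient. -/
lemma coeff_one_eq_zero_of_hasSum_const {c : ℕ → ℂ} {a : ℂ}
    (h : ∀ t : ℝ, HasSum (fun k => (t : ℂ) ^ k * c k) a) : c 1 = 0 := by
  let p : FormalMultilinearSeries ℝ ℝ ℂ :=
    fun k => ContinuousMultilinearMap.mkPiRing ℝ (Fin k) (c k)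
  have hp : ∀ k, p.coeff k = c k := fun k => by simp [p, FormalMultilinearSeries.coeff]
  have h1 : HasFPowerSeriesAt (fun _ : ℝ => a) p 0 := by
    rw [hasFPowerSeriesAt_iff]
    refine Filter.Eventually.of_forall fun t => ?_
    simpa only [hp, Complex.real_smul, Complex.ofReal_pow] using h t
  have h2 := h1.eq_formalMultilinearSeries (hasFPowerSeriesAt_const (c := a) (e := (0 : ℝ)))
  rw [← hp, h2]
  simp [FormalMultilinearSeries.coeff]

/-- Along `t ↦ exp(tα)` with `t` real, each coefficient is a constant power series in `t`; its
linear term is the corresponding coefficient of `uGen α ψ`. -/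
lemma uGen_apply_eq_zero {ψ : Amp (Mode4 N)} (hψ : IsUNInvariant ψ)
    {α : Matrix (Fin N) (Fin N) ℂ} (hα : α.conjTranspose = -α) : uGen α ψ = 0 := by
  funext n
  have h : ∀ t : ℝ, HasSum (fun k : ℕ => (t : ℂ) ^ k * ((k.factorial : ℂ)⁻¹ * (uGen α ^ k) ψ n))
      (ψ n) := fun t => by
    have h1 := Pi.hasSum.1 (hψ ((t : ℂ) • α) (by
      rw [Matrix.conjTranspose_smul, hα, smul_neg, Complex.star_def, Complex.conj_ofReal])) n
    convert h1 using 2 with k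
    rw [uGen_real_smul, smul_pow, LinearMap.smul_apply, Pi.smul_apply, Pi.smul_apply, smul_eq_mul,
      smul_eq_mul]
    ring
  simpa using coeff_one_eq_zero_of_hasSum_const h

lemma isUNInvariant_iff {ψ : Amp (Mode4 N)} : IsUNInvariant ψ ↔ ∀ i j : Fin N, C i j ψ = 0 := by
  constructor
  · intro hψ i j
    have hsum : ∀ z : ℂ, ∑ a, ∑ b, (z • Matrix.single i j (1 : ℂ)) a b • C a b ψ = z • C i j ψ := by
      intro z
      simp [Matrix.single_apply, ite_and]
    have hsum' : ∀ z : ℂ, ∑ a, ∑ b, (z • Matrix.single j i (1 : ℂ)) a b • C a b ψ = z • C j i ψ := by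
      intro z
      simp [Matrix.single_apply, ite_and]
    -- The matrices `z e_ij - conj(z) e_ji` are anti-Hermitian; `z = 1` and `z = I` together
    -- separate `C_ij` from `C_ji`.
    have key : ∀ z : ℂ, z • C i j ψ = starRingEnd ℂ z • C j i ψ := by
      intro z
      have hα : (z • Matrix.single i j (1 : ℂ) - starRingEnd ℂ z • Matrix.single j i (1 : ℂ)).conjTranspose
          = -(z • Matrix.single i j (1 : ℂ) - starRingEnd ℂ z • Matrix.single j i (1 : ℂ)) := by
        simp [Matrix.conjTranspose_sub]
      have h := uGen_apply_eq_zero hψ hα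
      rw [uGen_eq hα] at h
      simp only [LinearMap.sum_apply, LinearMap.smul_apply, Matrix.sub_apply, sub_smul,
        Finset.sum_sub_distrib, hsum, hsum'] at h
      exact sub_eq_zero.1 h
    have h1 := key 1
    have h2 := key Complex.I
    rw [map_one, one_smul, one_smul] at h1
    rw [← h1, Complex.conj_I, neg_smul, eq_neg_iff_add_eq_zero, ← add_smul,
      smul_eq_zero_iff_right (by simp)] at h2
    exact h2
  · intro h α hα
    have h0 : uGen α ψ = 0 := by
      rw [uGen_eq hα]
      simp [LinearMap.sum_apply, h]
    convert hasSum_single (f := fun k : ℕ => ((k.factorial : ℂ)⁻¹) • (uGen α ^ k) ψ) 0 ?_ using 1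
    · simp
    · intro k hk
      obtain ⟨m, rfl⟩ := Nat.exists_eq_succ_of_ne_zero hk
      rw [pow_succ, Module.End.mul_apply, h0, map_zero, smul_zero]

end Invariance

/-! ### The solution space inside the Fock space -/

section Hilbert

variable {N : ℕ}

lemma amp_ket (J : ℕ) : amp (Mode4 N) (ket N J) = ketAmp N J := rfl

lemma amp_injective (M : Type) : Function.Injective (amp M) := fun _ _ h => lp.ext h

lemma ket_mem_HC (J : ℕ) : ket N J ∈ HC N := ketAmp_mem_solutions J

lemma ket_ne_zero (hN : 2 ≤ N) (J : ℕ) : ket N J ≠ 0 := fun h =>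
  ketAmp_ne_zero hN J (by rw [← amp_ket, h, map_zero])

/-! #### Area sectors -/

lemma numTot_areaSpace {J : ℕ} {φ : Amp (Mode N)} (hφ : φ ∈ areaSpace N J) :
    numTot (id : Mode N → Mode N) 0 φ = (J : ℂ) • φ := by
  have h : areaSpace N J ≤ LinearMap.ker
      (numTot (id : Mode N → Mode N) 0 - (J : ℂ) • (1 : Module.End ℂ (Amp (Mode N)))) := by
    refine iSup₂_le fun k hk ψ hψ => ?_
    obtain ⟨h1, h2⟩ := Submodule.mem_inf.1 hψ
    have h3 : ∀ i, E (id : Mode N → Mode N) i i ψ = (k i : ℂ) • ψ := fun i => by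
      have := (Submodule.mem_iInf _).1 h2 i
      rwa [LinearMap.mem_ker, LinearMap.sub_apply, sub_eq_zero] at this
    have h4 : (∑ i, E (id : Mode N → Mode N) i i) ψ = ((2 * J : ℕ) : ℂ) • ψ := by
      rw [LinearMap.sum_apply, Finset.sum_congr rfl fun i _ => h3 i, ← Finset.sum_smul, ← hk]
      push_cast; rfl
    rw [sum_E_eq, LinearMap.add_apply, numTot_one_apply h1, ← two_smul ℂ, Nat.cast_mul, mul_smul]
      at h4
    rw [LinearMap.mem_ker, LinearMap.sub_apply, sub_eq_zero]
    exact smul_right_injective _ (two_ne_zero : (2 : ℂ) ≠ 0) h4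
  have := h hφ
  rwa [LinearMap.mem_ker, LinearMap.sub_apply, sub_eq_zero] at this

lemma numTot_sector {J : ℕ} {ψ : Fock (Mode4 N)} (hψ : ψ ∈ sector N J) :
    numTot (L N) 0 (amp _ ψ) = (J : ℂ) • amp _ ψ := by
  have h : Submodule.span ℂ (Set.image2 tens (areaSpace N J : Set (Amp (Mode N)))
      (areaSpace N J : Set (Amp (Mode N)))) ≤ LinearMap.ker
      (numTot (L N) 0 - (J : ℂ) • (1 : Module.End ℂ (Amp (Mode4 N)))) := by
    refine Submodule.span_le.2 ?_
    rintro _ ⟨φ, hφ, χ, -, rfl⟩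
    rw [SetLike.mem_coe, LinearMap.mem_ker, LinearMap.sub_apply, sub_eq_zero]
    funext n
    have h1 := congrFun (numTot_areaSpace hφ) (n ∘ Sum.inl)
    rw [numTot_apply] at h1 ⊢
    simp only [tens, LinearMap.smul_apply, Module.End.one_apply, Pi.smul_apply, smul_eq_mul,
      id_eq, Function.comp_apply] at h1 ⊢
    rw [← mul_assoc, h1, mul_assoc]
  have := h hψ
  rwa [LinearMap.mem_ker, LinearMap.sub_apply, sub_eq_zero] at this

/-- `F†_kl` adds one quantum to each of the legs `k` and `l`, hence one unit to the area, and
preserves invariance. -/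
lemma Fdag_mem_areaSpace {J : ℕ} (k l : Fin N) {φ : Amp (Mode N)} (hφ : φ ∈ areaSpace N J) :
    Fdag (id : Mode N → Mode N) k l φ ∈ areaSpace N (J + 1) := by
  have h : areaSpace N J ≤ (areaSpace N (J + 1)).comap (Fdag (id : Mode N → Mode N) k l) := by
    refine iSup₂_le fun m hm ψ hψ => ?_
    obtain ⟨h1, h2⟩ := Submodule.mem_inf.1 hψ
    refine (le_iSup₂_of_le (f := fun (k : Fin N → ℕ) (_ : ∑ i, k i = 2 * (J + 1)) =>
      intertwiners k) (m + Pi.single k 1 + Pi.single l 1) ?_ le_rfl) ?_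
    · simp [Finset.sum_add_distrib, hm]; ring
    · refine Submodule.mem_inf.2 ⟨Fdag_mem_su2Invariants Function.injective_id k l h1,
        (Submodule.mem_iInf _).2 fun i => ?_⟩
      have h3 := (Submodule.mem_iInf _).1 h2 i
      rw [LinearMap.mem_ker, LinearMap.sub_apply, sub_eq_zero] at h3 ⊢
      have h4 := LinearMap.congr_fun (sub_eq_iff_eq_add.1
        (E_bracket_Fdag (Function.injective_id (α := Mode N)) i i k l)) ψ
      rw [Module.End.mul_apply] at h4
      rw [h4, LinearMap.add_apply, Module.End.mul_apply, h3]
      simp only [LinearMap.smul_apply, Module.End.one_apply, Pi.add_apply, Pi.single_apply,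
        LinearMap.add_apply, map_smul]
      split_ifs <;> subst_vars <;> (try simp only [LinearMap.zero_apply]) <;> push_cast <;> module
  exact h hφ

lemma Fdag_L_tens (k l : Fin N) (φ χ : Amp (Mode N)) :
    Fdag (L N) k l (tens φ χ) = tens (Fdag (id : Mode N → Mode N) k l φ) χ := by
  have h : ∀ (x : Mode N) (φ : Amp (Mode N)), cre (L N x) (tens φ χ) = tens (cre x φ) χ := by
    intro x φ
    funext n
    have h1 : (n - Pi.single (L N x) 1) ∘ Sum.inl = n ∘ Sum.inl - Pi.single x 1 := by
      funext y; simp [Pi.single_apply]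
    have h2 : (n - Pi.single (L N x) 1) ∘ Sum.inr = n ∘ Sum.inr := by
      funext y; simp
    simp only [cre_apply, tens, h1, h2, Function.comp_apply]
    ring
  simp only [Fdag, LinearMap.sub_apply, Module.End.mul_apply, h, id]
  funext n
  simp only [Pi.sub_apply, tens]
  ring

lemma Fdag_R_tens (k l : Fin N) (φ χ : Amp (Mode N)) :
    Fdag (R N) k l (tens φ χ) = tens φ (Fdag (id : Mode N → Mode N) k l χ) := by
  have h : ∀ (x : Mode N) (χ : Amp (Mode N)), cre (R N x) (tens φ χ) = tens φ (cre x χ) := by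
    intro x χ
    funext n
    have h1 : (n - Pi.single (R N x) 1) ∘ Sum.inr = n ∘ Sum.inr - Pi.single x 1 := by
      funext y; simp [Pi.single_apply]
    have h2 : (n - Pi.single (R N x) 1) ∘ Sum.inl = n ∘ Sum.inl := by
      funext y; simp
    simp only [cre_apply, tens, h1, h2, Function.comp_apply]
    ring
  simp only [Fdag, LinearMap.sub_apply, Module.End.mul_apply, h, id]
  funext n
  simp only [Pi.sub_apply, tens]
  ring

lemma vac_mem_areaSpace : vac (Mode N) ∈ areaSpace N 0 := by
  refine (le_iSup₂_of_le (f := fun (k : Fin N → ℕ) (_ : ∑ i, k i = 2 * 0) =>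
      intertwiners k) 0 (by simp) le_rfl) ?_
  refine Submodule.mem_inf.2 ⟨vac_mem_su2Invariants Function.injective_id,
    (Submodule.mem_iInf _).2 fun i => ?_⟩
  simp [LinearMap.mem_ker, E_vac]

lemma vac_eq_tens : vac (Mode4 N) = tens (vac (Mode N)) (vac (Mode N)) := by
  funext n
  by_cases h1 : n ∘ Sum.inl = 0
  · by_cases h2 : n ∘ Sum.inr = 0
    · have h : n = 0 := by
        funext x; rcases x with x | x
        · exact congrFun h1 x
        · exact congrFun h2 x
      simp [tens, vac, h]
    · have h : n ≠ 0 := fun h => h2 (by rw [h]; rfl)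
      simp [tens, vac, h, h2]
  · have h : n ≠ 0 := fun h => h1 (by rw [h]; rfl)
    simp [tens, vac, h, h1]

lemma ket_mem_sector (J : ℕ) : ket N J ∈ sector N J := by
  change ketAmp N J ∈ Submodule.span ℂ (Set.image2 tens (areaSpace N J : Set (Amp (Mode N)))
    (areaSpace N J : Set (Amp (Mode N))))
  induction J with
  | zero =>
    refine Submodule.subset_span ⟨vac _, vac_mem_areaSpace, vac _, vac_mem_areaSpace, ?_⟩
    rw [ketAmp_zero, vac_eq_tens]
  | succ J ih =>
    rw [ketAmp_succ]
    have h : Submodule.span ℂ (Set.image2 tens (areaSpace N J : Set (Amp (Mode N)))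
        (areaSpace N J : Set (Amp (Mode N)))) ≤ (Submodule.span ℂ (Set.image2 tens
        (areaSpace N (J + 1) : Set (Amp (Mode N))) (areaSpace N (J + 1) : Set (Amp (Mode N))))).comap
        (fdag N) := by
      refine Submodule.span_le.2 ?_
      rintro _ ⟨φ, hφ, χ, hχ, rfl⟩
      rw [SetLike.mem_coe, Submodule.mem_comap, fdag, LinearMap.sum_apply]
      refine sum_mem fun k _ => ?_
      rw [LinearMap.sum_apply]
      refine sum_mem fun l _ => ?_
      rw [Module.End.mul_apply, Fdag_R_tens, Fdag_L_tens]
      exact Submodule.subset_span ⟨_, Fdag_mem_areaSpace k l hφ, _, Fdag_mem_areaSpace k l hχ, rfl⟩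
    exact h ih

theorem HC_inf_sector (hN : 2 ≤ N) (J : ℕ) :
    HC N ⊓ sector N J = Submodule.span ℂ {ket N J} := by
  refine le_antisymm ?_ ?_
  · rintro ψ ⟨h1, h2⟩
    obtain ⟨c, hc⟩ := exists_smul_ketAmp hN J h1 (numTot_sector h2)
    refine Submodule.mem_span_singleton.2 ⟨c, amp_injective _ ?_⟩
    rw [map_smul, amp_ket, hc]
  · rw [Submodule.span_singleton_le_iff_mem]
    exact ⟨ket_mem_HC J, ket_mem_sector J⟩

/-! #### Orthogonality and completeness -/

lemma ketAmp_apply_eq_zero {J : ℕ} {n : Mode4 N → ℕ} (h : ∑ i, n (L N (i, 0)) ≠ J) :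
    ketAmp N J n = 0 := by
  by_contra hn
  exact h (occupation_of_numTot (numTot_ketAmp J) hn)

lemma inner_ket_ket {J K : ℕ} (h : J ≠ K) : inner ℂ (ket N J) (ket N K) = 0 := by
  rw [lp.inner_eq_tsum]
  refine (tsum_congr fun n => ?_).trans tsum_zero
  change inner ℂ (ketAmp N J n) (ketAmp N K n) = 0
  by_cases hJ : ∑ i, n (L N (i, 0)) = J
  · rw [ketAmp_apply_eq_zero (J := K) (by rw [hJ]; exact h), inner_zero_right]
  · rw [ketAmp_apply_eq_zero hJ, inner_zero_left]

/-- In the topology of pointwise convergence each output coefficient of a generator depends on a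
single input coefficient. So kernels are closed even though the operators are unbounded on the Fock
space. -/
lemma continuous_of_mem_oscAlg {M : Type} [DecidableEq M] {e : Mode N → M}
    {A : Module.End ℂ (Amp M)} (hA : A ∈ oscAlg e) : Continuous A := by
  induction hA using Algebra.adjoin_induction with
  | mem A h =>
    rcases h with ⟨x, rfl⟩ | ⟨x, rfl⟩
    · exact continuous_pi fun n => continuous_const.mul (continuous_apply _)
    · exact continuous_pi fun n => continuous_const.mul (continuous_apply _)
  | algebraMap r => exact continuous_id.const_smul r
  | add A B _ _ hA hB => exact hA.add hB
  | mul A B _ _ hA hB => exact hA.comp hB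

lemma continuous_amp (M : Type) : Continuous (amp M) :=
  lp.uniformContinuous_coe.continuous

lemma isClosed_HC : IsClosed (HC N : Set (Fock (Mode4 N))) := by
  have hc : ∀ {A : Module.End ℂ (Amp (Mode4 N))}, Continuous A →
      IsClosed {ψ : Fock (Mode4 N) | A (amp _ ψ) = 0} := fun h =>
    isClosed_eq (h.comp (continuous_amp _)) continuous_const
  have h : (HC N : Set (Fock (Mode4 N))) =
      ((({ψ | (∑ i, Jz (L N) i) (amp _ ψ) = 0} ∩ {ψ | (∑ i, Jp (L N) i) (amp _ ψ) = 0} ∩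
        {ψ | (∑ i, Jm (L N) i) (amp _ ψ) = 0}) ∩
      ({ψ | (∑ i, Jz (R N) i) (amp _ ψ) = 0} ∩ {ψ | (∑ i, Jp (R N) i) (amp _ ψ) = 0} ∩
        {ψ | (∑ i, Jm (R N) i) (amp _ ψ) = 0})) ∩
      ⋂ i : Fin N, ⋂ j : Fin N, {ψ | C i j (amp _ ψ) = 0}) := by
    ext ψ
    rw [SetLike.mem_coe, HC_eq_comap, Submodule.mem_comap, mem_solutions_iff,
      mem_su2Invariants_iff, mem_su2Invariants_iff]
    simp only [Set.mem_inter_iff, Set.mem_iInter, Set.mem_ofPred_eq, and_assoc]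
  rw [h]
  have hz := fun e : Mode N → Mode4 N =>
    hc (continuous_of_mem_oscAlg (e := e) (sum_mem fun i (_ : i ∈ Finset.univ) => Jz_mem_oscAlg e i))
  have hp := fun e : Mode N → Mode4 N =>
    hc (continuous_of_mem_oscAlg (e := e) (sum_mem fun i (_ : i ∈ Finset.univ) => Jp_mem_oscAlg e i))
  have hm := fun e : Mode N → Mode4 N =>
    hc (continuous_of_mem_oscAlg (e := e) (sum_mem fun i (_ : i ∈ Finset.univ) => Jm_mem_oscAlg e i))
  refine ((((hz _).inter (hp _)).inter (hm _)).inter (((hz _).inter (hp _)).inter (hm _))).inter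
    (isClosed_iInter fun i => isClosed_iInter fun j => hc ?_)
  exact (continuous_of_mem_oscAlg (E_mem_oscAlg _ _ _)).sub
    (continuous_of_mem_oscAlg (E_mem_oscAlg _ _ _))

lemma eq_zero_of_orthogonal (hN : 2 ≤ N) {ψ : Fock (Mode4 N)} (hψ : ψ ∈ HC N)
    (h : ∀ J, inner ℂ (ket N J) ψ = 0) : ψ = 0 := by
  have hlevel : ∀ J, levelProj N J (amp _ ψ) = 0 := fun J => by
    obtain ⟨c, hc⟩ := exists_levelProj_eq hN hψ J
    -- `|J⟩` is supported on area `J`, where `ψ` coincides with `c |J⟩`.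
    have h1 : inner ℂ (ket N J) ψ = inner ℂ (ket N J) (c • ket N J) := by
      rw [lp.inner_eq_tsum, lp.inner_eq_tsum]
      refine tsum_congr fun n => ?_
      change inner ℂ (ketAmp N J n) (amp _ ψ n) = inner ℂ (ketAmp N J n) ((c • ketAmp N J) n)
      by_cases hJ : ∑ i, n (L N (i, 0)) = J
      · rw [solution_apply hψ, hJ, hc]
      · rw [ketAmp_apply_eq_zero hJ, inner_zero_left, inner_zero_left]
    rw [h J, inner_smul_right] at h1
    have h2 : c = 0 := (mul_eq_zero.1 h1.symm).resolve_right
      (inner_self_ne_zero.2 (ket_ne_zero hN J))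
    rw [hc, h2, zero_smul]
  refine amp_injective _ (funext fun n => ?_)
  rw [solution_apply hψ, hlevel, map_zero]

/-- Split `ψ` along the closed span and its orthogonal complement. The orthogonal part is again a
solution, and it is orthogonal to every `|J⟩`. -/
theorem HC_eq_topologicalClosure (hN : 2 ≤ N) :
    HC N = (⨆ J : ℕ, Submodule.span ℂ {ket N J}).topologicalClosure := by
  set S := (⨆ J : ℕ, Submodule.span ℂ {ket N J}).topologicalClosure with hS
  have hle : S ≤ HC N := Submodule.topologicalClosure_minimal _
    (iSup_le fun J => (Submodule.span_singleton_le_iff_mem _ _).2 (ket_mem_HC J)) isClosed_HC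
  refine le_antisymm (fun ψ hψ => ?_) hle
  have : CompleteSpace S := (Submodule.isClosed_topologicalClosure _).completeSpace_coe
  obtain ⟨s, hs, t, ht, rfl⟩ := S.exists_add_mem_mem_orthogonal ψ
  have ht' : t ∈ HC N := by
    have := sub_mem hψ (hle hs)
    rwa [add_sub_cancel_left] at this
  have h0 : t = 0 := eq_zero_of_orthogonal hN ht' fun J =>
    (Submodule.mem_orthogonal _ _).1 ht _ (Submodule.le_topologicalClosure _
      (Submodule.mem_iSup_of_mem J (Submodule.mem_span_singleton_self _)))
  rw [h0, add_zero]
  exact hs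

end Hilbert

/-! ### Relabelling of oscillators -/

section Permutations

variable {M : Type} [DecidableEq M] {N : ℕ}

/-- Relabelling of the oscillators. -/
def permOp (τ : Equiv.Perm M) : Module.End ℂ (Amp M) where
  toFun ψ := fun n => ψ (n ∘ τ)
  map_add' _ _ := rfl
  map_smul' _ _ := rfl

omit [DecidableEq M] in
lemma permOp_apply (τ : Equiv.Perm M) (ψ : Amp M) (n : M → ℕ) : permOp τ ψ n = ψ (n ∘ τ) := rfl

lemma single_comp_perm (τ : Equiv.Perm M) (x : M) :
    (Pi.single (τ x) 1 : M → ℕ) ∘ τ = Pi.single x 1 := by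
  funext y
  simp [Pi.single_apply]

lemma permOp_mul_cre (τ : Equiv.Perm M) (x : M) : permOp τ * cre x = cre (τ x) * permOp τ := by
  refine LinearMap.ext fun ψ => funext fun n => ?_
  simp only [Module.End.mul_apply, permOp_apply, cre_apply, Function.comp_apply, Pi.sub_comp,
    single_comp_perm]

lemma permOp_mul_ann (τ : Equiv.Perm M) (x : M) : permOp τ * ann x = ann (τ x) * permOp τ := by
  refine LinearMap.ext fun ψ => funext fun n => ?_
  simp only [Module.End.mul_apply, permOp_apply, ann_apply, Function.comp_apply, Pi.add_comp,
    single_comp_perm]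

omit [DecidableEq M] in
lemma permOp_mul_mul {τ : Equiv.Perm M} {A A' B B' : Module.End ℂ (Amp M)}
    (hA : permOp τ * A = A' * permOp τ) (hB : permOp τ * B = B' * permOp τ) :
    permOp τ * (A * B) = A' * B' * permOp τ := by
  rw [← mul_assoc, hA, mul_assoc, hB, mul_assoc]

omit [DecidableEq M] in
lemma permOp_vac (τ : Equiv.Perm M) : permOp τ (vac M) = vac M := by
  funext n
  by_cases h : n = 0
  · subst h; rfl
  · have h' : n ∘ τ ≠ 0 := fun h' => h (by
      funext x; simpa using congrFun h' (τ.symm x))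
    simp [permOp_apply, vac, h, h']

omit [DecidableEq M] in
lemma braket_permOp (τ : Equiv.Perm M) (φ χ : Amp M) :
    braket (permOp τ φ) (permOp τ χ) = braket φ χ :=
  (τ.symm.arrowCongr (Equiv.refl ℕ)).tsum_eq fun n => starRingEnd ℂ (φ n) * χ n

variable {e : Mode N → M} {τ : Equiv.Perm M} {σ : Equiv.Perm (Fin N)}
  (hτ : ∀ i s, τ (e (i, s)) = e (σ i, s))
include hτ

lemma permOp_mul_E (i j : Fin N) : permOp τ * E e i j = E e (σ i) (σ j) * permOp τ := by
  rw [E, E, mul_add, add_mul, permOp_mul_mul (permOp_mul_cre _ _) (permOp_mul_ann _ _),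
    permOp_mul_mul (permOp_mul_cre _ _) (permOp_mul_ann _ _), hτ, hτ, hτ, hτ]

lemma permOp_mul_Fdag (i j : Fin N) : permOp τ * Fdag e i j = Fdag e (σ i) (σ j) * permOp τ := by
  rw [Fdag, Fdag, mul_sub, sub_mul, permOp_mul_mul (permOp_mul_cre _ _) (permOp_mul_cre _ _),
    permOp_mul_mul (permOp_mul_cre _ _) (permOp_mul_cre _ _), hτ, hτ, hτ, hτ]

lemma permOp_mul_JJ (i j : Fin N) : permOp τ * JJ e i j = JJ e (σ i) (σ j) * permOp τ := by
  have hp : ∀ i, permOp τ * Jp e i = Jp e (σ i) * permOp τ := fun i => by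
    rw [Jp, Jp, permOp_mul_mul (permOp_mul_cre _ _) (permOp_mul_ann _ _), hτ, hτ]
  have hm : ∀ i, permOp τ * Jm e i = Jm e (σ i) * permOp τ := fun i => by
    rw [Jm, Jm, permOp_mul_mul (permOp_mul_ann _ _) (permOp_mul_cre _ _), hτ, hτ]
  have hz : ∀ i, permOp τ * Jz e i = Jz e (σ i) * permOp τ := fun i => by
    rw [Jz, Jz, mul_smul_comm, mul_sub, permOp_mul_mul (permOp_mul_cre _ _) (permOp_mul_ann _ _),
      permOp_mul_mul (permOp_mul_cre _ _) (permOp_mul_ann _ _), hτ, hτ, smul_mul_assoc, sub_mul]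
  rw [JJ, JJ, mul_add, mul_smul_comm, mul_add, permOp_mul_mul (hz i) (hz j),
    permOp_mul_mul (hp i) (hm j), permOp_mul_mul (hm i) (hp j), add_mul, smul_mul_assoc, add_mul]

end Permutations

/-! ### Leg-permutation symmetry and cross simplicity -/

section LegPermutations

variable {N : ℕ}

/-- The relabelling of all oscillators by a permutation of the legs. -/
def legPerm (σ : Equiv.Perm (Fin N)) : Equiv.Perm (Mode4 N) :=
  Equiv.sumCongr (Equiv.prodCongr σ (Equiv.refl _)) (Equiv.prodCongr σ (Equiv.refl _))

lemma legPerm_L (σ : Equiv.Perm (Fin N)) (i : Fin N) (s : Fin 2) :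
    legPerm σ (L N (i, s)) = L N (σ i, s) := rfl

lemma legPerm_R (σ : Equiv.Perm (Fin N)) (i : Fin N) (s : Fin 2) :
    legPerm σ (R N (i, s)) = R N (σ i, s) := rfl

lemma permOp_ketAmp (σ : Equiv.Perm (Fin N)) (J : ℕ) :
    permOp (legPerm σ) (ketAmp N J) = ketAmp N J := by
  have h : permOp (legPerm σ) * fdag N = fdag N * permOp (legPerm σ) := by
    simp only [fdag, Finset.mul_sum, Finset.sum_mul]
    conv_rhs => rw [← Equiv.sum_comp σ]
    refine Finset.sum_congr rfl fun k _ => ?_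
    conv_rhs => rw [← Equiv.sum_comp σ]
    refine Finset.sum_congr rfl fun l _ => ?_
    exact permOp_mul_mul (permOp_mul_Fdag (legPerm_L σ) k l) (permOp_mul_Fdag (legPerm_R σ) k l)
  induction J with
  | zero => exact permOp_vac _
  | succ J ih => rw [ketAmp_succ, ← Module.End.mul_apply, h, Module.End.mul_apply, ih]

/-- Solutions are symmetric under permutations of the legs. -/
theorem permOp_solution (hN : 2 ≤ N) (σ : Equiv.Perm (Fin N)) {ψ : Amp (Mode4 N)}
    (hψ : ψ ∈ solutions N) : permOp (legPerm σ) ψ = ψ := by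
  funext n
  have hs : ∑ i, (n ∘ legPerm σ) (L N (i, 0)) = ∑ i, n (L N (i, 0)) :=
    Equiv.sum_comp σ fun i => n (L N (i, 0))
  obtain ⟨c, hc⟩ := exists_levelProj_eq hN hψ (∑ i, n (L N (i, 0)))
  have hk := congrFun (permOp_ketAmp σ (∑ i, n (L N (i, 0)))) n
  rw [permOp_apply] at hk
  rw [permOp_apply, solution_apply hψ, hs, hc, solution_apply hψ n, hc, Pi.smul_apply,
    Pi.smul_apply, hk]

/-- Passing from left to right transposes indices and reverses products. This fixes `E_ij E_ji` and
exchanges the commuting `E_ii`, `E_jj`, so the agreement is exact. -/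
lemma JJ_L_apply {ψ : Amp (Mode4 N)} (hψ : ψ ∈ solutions N) {i j : Fin N} (hij : i ≠ j) :
    JJ (L N) i j ψ = JJ (R N) i j ψ := by
  have hEE : ∀ a b c d, E (L N) a b (E (L N) c d ψ) = E (R N) d c (E (R N) b a ψ) := by
    intro a b c d
    rw [E_L_apply hψ c d, ← Module.End.mul_apply,
      (commute_LR (E_mem_oscAlg _ a b) (E_mem_oscAlg _ d c)).eq, Module.End.mul_apply,
      E_L_apply hψ a b]
  have hcomm : E (R N) j j (E (R N) i i ψ) = E (R N) i i (E (R N) j j ψ) := by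
    have := LinearMap.congr_fun (E_bracket (R_injective (N := N)) j j i i) ψ
    rw [if_neg hij.symm, if_neg hij.symm, sub_zero, LinearMap.sub_apply, Module.End.mul_apply,
      Module.End.mul_apply, LinearMap.zero_apply, sub_eq_zero] at this
    exact this
  rw [JJ_eq_of_ne L_injective hij, JJ_eq_of_ne R_injective hij]
  simp only [LinearMap.sub_apply, LinearMap.smul_apply, Module.End.mul_apply, hEE,
    E_L_apply hψ i i, hcomm]

/-- Swapping legs `i` and `j` fixes `φ` and `ψ` but negates the operator, so the matrix element
equals its own negative. -/
lemma braket_E_sub_E (hN : 2 ≤ N) {φ ψ : Amp (Mode4 N)} (hφ : φ ∈ solutions N)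
    (hψ : ψ ∈ solutions N) (i j : Fin N) :
    braket φ (((1 / 2 : ℂ) • (E (R N) j j - E (R N) i i)) ψ) = 0 := by
  set χ := ((1 / 2 : ℂ) • (E (R N) j j - E (R N) i i)) ψ with hχ
  have h : ∀ k, permOp (legPerm (Equiv.swap i j)) (E (R N) k k ψ) =
      E (R N) (Equiv.swap i j k) (Equiv.swap i j k) ψ := fun k => by
    rw [← Module.End.mul_apply, permOp_mul_E (legPerm_R _), Module.End.mul_apply,
      permOp_solution hN _ hψ]
  have hanti : permOp (legPerm (Equiv.swap i j)) χ = -χ := by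
    rw [hχ, LinearMap.smul_apply, LinearMap.sub_apply, map_smul, map_sub, h, h,
      Equiv.swap_apply_left, Equiv.swap_apply_right, ← smul_neg, neg_sub]
  have h1 := braket_permOp (legPerm (Equiv.swap i j)) φ χ
  rw [permOp_solution hN _ hφ, hanti] at h1
  have h2 : braket φ (-χ) = -braket φ χ := by
    simp only [braket, Pi.neg_apply, mul_neg, tsum_neg]
  rw [h2] at h1
  exact self_eq_neg.1 h1.symm

end LegPermutations

/-! ### Growth of the expectation values -/

section Asymptotics

variable {N : ℕ}

lemma braket_sum_right {M ι : Type} {φ : Amp M} (hφ : φ ∈ finAmp M) (s : Finset ι)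
    (χ : ι → Amp M) : braket φ (∑ k ∈ s, χ k) = ∑ k ∈ s, braket φ (χ k) := by
  classical
  induction s using Finset.induction_on with
  | empty => simp [braket]
  | insert a s ha ih => rw [Finset.sum_insert ha, Finset.sum_insert ha, braket_add_right hφ, ih]

/-- Closure: the sum over `j` contracts `J_i` with the total angular momentum, which annihilates
`ψ`. -/
lemma sum_JJ_apply {M : Type} [DecidableEq M] {e : Mode N → M} {ψ : Amp M}
    (hψ : ψ ∈ su2Invariants e) (i : Fin N) : ∑ j, JJ e i j ψ = 0 := by
  obtain ⟨hz, hp, hm⟩ := mem_su2Invariants_iff.1 hψ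
  rw [LinearMap.sum_apply] at hz hp hm
  simp only [JJ, LinearMap.add_apply, LinearMap.smul_apply, Module.End.mul_apply,
    Finset.sum_add_distrib, ← Finset.smul_sum, ← map_sum, hz, hp, hm, map_zero, add_zero, smul_zero]

lemma braket_JJ_perm (σ : Equiv.Perm (Fin N)) (J : ℕ) (i j : Fin N) :
    braket (ketAmp N J) (JJ (L N) (σ i) (σ j) (ketAmp N J)) =
      braket (ketAmp N J) (JJ (L N) i j (ketAmp N J)) := by
  have h := braket_permOp (legPerm σ) (ketAmp N J) (JJ (L N) i j (ketAmp N J))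
  rwa [permOp_ketAmp, ← Module.End.mul_apply, permOp_mul_JJ (legPerm_L σ), Module.End.mul_apply,
    permOp_ketAmp] at h

/-- In the closure relation for leg `i`, permutation symmetry makes the `N - 1` off-diagonal terms
equal. -/
lemma braket_JJ_of_ne (J : ℕ) {i j : Fin N} (hij : i ≠ j) :
    (N - 1 : ℂ) * braket (ketAmp N J) (JJ (L N) i j (ketAmp N J)) =
      -braket (ketAmp N J) (JJ (L N) i i (ketAmp N J)) := by
  have h0 := braket_sum_right (ketAmp_mem_finAmp N J) Finset.univ
    fun k => JJ (L N) i k (ketAmp N J)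
  rw [sum_JJ_apply (mem_solutions_iff.1 (ketAmp_mem_solutions J)).1,
    ← Finset.add_sum_erase _ _ (Finset.mem_univ i)] at h0
  have h1 : ∀ k ∈ Finset.univ.erase i, braket (ketAmp N J) (JJ (L N) i k (ketAmp N J)) =
      braket (ketAmp N J) (JJ (L N) i j (ketAmp N J)) := fun k hk => by
    have := braket_JJ_perm (Equiv.swap j k) J i j
    rwa [Equiv.swap_apply_left, Equiv.swap_apply_of_ne_of_ne hij (Finset.ne_of_mem_erase hk).symm]
      at this
  have hN : 1 ≤ N := i.pos
  rw [Finset.sum_congr rfl h1, Finset.sum_const, Finset.card_erase_of_mem (Finset.mem_univ i),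
    Finset.card_univ, Fintype.card_fin, nsmul_eq_mul, Nat.cast_sub hN, Nat.cast_one] at h0
  have h2 : braket (ketAmp N J) (0 : Amp (Mode4 N)) = 0 := by simp [braket]
  rw [h2] at h0
  linear_combination -h0

/-- The eigenvalue of `∑ₖ (Jₖ)²` at an occupation number. -/
def casimirSum (n : Mode4 N → ℕ) : ℝ :=
  ∑ k, ((n (L N (k, 0)) + n (L N (k, 1)) : ℝ) / 2 * ((n (L N (k, 0)) + n (L N (k, 1))) / 2 + 1))

/-- The squared norm of `|J⟩`. -/
def ketNormSq (N J : ℕ) : ℝ := ∑' n, ‖ketAmp N J n‖ ^ 2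

lemma conj_mul_real_mul (z : ℂ) (r : ℝ) : starRingEnd ℂ z * (r * z) = ((r * ‖z‖ ^ 2 : ℝ) : ℂ) := by
  rw [mul_left_comm, Complex.conj_mul']
  push_cast; ring

lemma braket_ketAmp_self (J : ℕ) : braket (ketAmp N J) (ketAmp N J) = (ketNormSq N J : ℂ) := by
  rw [braket, ketNormSq, Complex.ofReal_tsum]
  refine tsum_congr fun n => ?_
  rw [Complex.conj_mul', Complex.ofReal_pow]

/-- All legs have the same Casimir expectation, so one leg is traded for the sum over legs, which
can be bounded by the area alone. -/
lemma braket_JJ_self (J : ℕ) (i : Fin N) :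
    (N : ℂ) * braket (ketAmp N J) (JJ (L N) i i (ketAmp N J)) =
      ((∑' n, casimirSum n * ‖ketAmp N J n‖ ^ 2 : ℝ) : ℂ) := by
  have h1 : ∀ k ∈ Finset.univ, braket (ketAmp N J) (JJ (L N) k k (ketAmp N J)) =
      braket (ketAmp N J) (JJ (L N) i i (ketAmp N J)) := fun k _ => by
    have := braket_JJ_perm (Equiv.swap i k) J i i
    rwa [Equiv.swap_apply_left] at this
  have h0 := braket_sum_right (ketAmp_mem_finAmp N J) Finset.univ
    fun k => JJ (L N) k k (ketAmp N J)
  rw [Finset.sum_congr rfl h1, Finset.sum_const, Finset.card_univ, Fintype.card_fin,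
    nsmul_eq_mul] at h0
  rw [← h0, braket, Complex.ofReal_tsum]
  refine tsum_congr fun n => ?_
  rw [← conj_mul_real_mul, Finset.sum_apply]
  simp only [JJ_self_apply L_injective, ← Finset.sum_mul]
  rw [casimirSum]
  push_cast; rfl

/-- With `κ_k = 2j_k` and `∑ κ_k = 2J`, the Casimir sum is `∑ κ_k²/4 + J`. Cauchy–Schwarz bounds `∑
κ_k²` below by `4J²/N`, and nonnegativity bounds it above by `4J²`. -/
lemma casimirSum_bounds {J : ℕ} {n : Mode4 N → ℕ} (hn : ketAmp N J n ≠ 0) :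
    (J : ℝ) ^ 2 ≤ N * casimirSum n ∧ casimirSum n ≤ J ^ 2 + J := by
  have h0 : ∑ k, (n (L N (k, 0)) + n (L N (k, 1)) : ℝ) = 2 * J := by
    have h1 := occupation_of_numTot (numTot_ketAmp J) hn
    have h2 := (occupation_eq (ketAmp_mem_solutions J) hn).1
    rw [Finset.sum_add_distrib]
    rw [h1] at h2
    rw [← Nat.cast_sum, ← Nat.cast_sum, h1, h2]
    ring
  set κ : Fin N → ℝ := fun k => (n (L N (k, 0)) + n (L N (k, 1)) : ℝ) with hκ
  have hpos : ∀ k, 0 ≤ κ k := fun k => by positivity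
  have hc : casimirSum n = (∑ k, κ k ^ 2) / 4 + J := by
    have : casimirSum n = ∑ k, (κ k ^ 2 / 4 + κ k / 2) :=
      Finset.sum_congr rfl fun k _ => by rw [hκ]; ring
    rw [this, Finset.sum_add_distrib, ← Finset.sum_div, ← Finset.sum_div, h0]
    ring
  have hle : ∑ k, κ k ^ 2 ≤ (2 * J) ^ 2 := by
    rw [sq (2 * (J : ℝ)), ← h0, Finset.sum_mul]
    refine Finset.sum_le_sum fun k _ => ?_
    rw [sq]
    exact mul_le_mul_of_nonneg_left
      (Finset.single_le_sum (fun k _ => hpos k) (Finset.mem_univ k)) (hpos k)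
  have hge : (2 * (J : ℝ)) ^ 2 ≤ N * ∑ k, κ k ^ 2 := by
    have := sq_sum_le_card_mul_sum_sq (s := Finset.univ) (f := κ)
    rwa [h0, Finset.card_univ, Fintype.card_fin] at this
  rw [hc]
  constructor
  · nlinarith [mul_nonneg (Nat.cast_nonneg (α := ℝ) N) (Nat.cast_nonneg (α := ℝ) J)]
  · nlinarith

lemma summable_mul_ketAmp (J : ℕ) (g : (Mode4 N → ℕ) → ℝ) :
    Summable fun n => g n * ‖ketAmp N J n‖ ^ 2 :=
  summable_of_hasFiniteSupport ((ketAmp_mem_finAmp N J).subset fun n hn h => by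
    exact hn (by simp [h]))

lemma ketNormSq_pos (hN : 2 ≤ N) (J : ℕ) : 0 < ketNormSq N J := by
  obtain ⟨n, hn⟩ := Function.ne_iff.1 (ketAmp_ne_zero hN J)
  have hs := summable_mul_ketAmp (N := N) J fun _ => 1
  simp only [one_mul] at hs
  exact hs.tsum_pos (fun _ => by positivity) n (by have := norm_pos_iff.2 hn; positivity)

lemma tsum_casimirSum_bounds (J : ℕ) :
    (J : ℝ) ^ 2 * ketNormSq N J ≤ N * ∑' n, casimirSum n * ‖ketAmp N J n‖ ^ 2 ∧
      ∑' n, casimirSum n * ‖ketAmp N J n‖ ^ 2 ≤ (J ^ 2 + J) * ketNormSq N J := by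
  rw [ketNormSq, ← tsum_mul_left, ← tsum_mul_left, ← tsum_mul_left]
  constructor
  · refine Summable.tsum_le_tsum (fun n => ?_) (summable_mul_ketAmp J _)
      ((summable_mul_ketAmp J _).mul_left _)
    by_cases hn : ketAmp N J n = 0
    · simp [hn]
    · rw [← mul_assoc]
      exact mul_le_mul_of_nonneg_right (casimirSum_bounds hn).1 (by positivity)
  · refine Summable.tsum_le_tsum (fun n => ?_) (summable_mul_ketAmp J _)
      (summable_mul_ketAmp J _)
    by_cases hn : ketAmp N J n = 0
    · simp [hn]
    · exact mul_le_mul_of_nonneg_right (casimirSum_bounds hn).2 (by positivity)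

lemma norm_expect_JJ (hN : 2 ≤ N) (J : ℕ) {i j : Fin N} (hij : i ≠ j) :
    N * (N - 1) * ‖expect J (JJ (L N) i j)‖ =
      (∑' n, casimirSum n * ‖ketAmp N J n‖ ^ 2) / ketNormSq N J := by
  set r := ∑' n, casimirSum n * ‖ketAmp N J n‖ ^ 2 with hr
  have h1 := braket_JJ_of_ne J hij
  have h2 := braket_JJ_self J i
  have h3 : (((N * (N - 1) : ℝ)) : ℂ) * expect J (JJ (L N) i j) = ((-(r / ketNormSq N J) : ℝ) : ℂ) := by
    rw [expect, braket_ketAmp_self]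
    push_cast
    rw [mul_assoc, ← mul_div_assoc, h1, neg_div, mul_neg, ← mul_div_assoc, h2]
  have hN' : (2 : ℝ) ≤ N := by exact_mod_cast hN
  have hr0 : 0 ≤ r := by
    have := (tsum_casimirSum_bounds (N := N) J).1
    have h4 : 0 ≤ (J : ℝ) ^ 2 * ketNormSq N J := by
      have := ketNormSq_pos hN J; positivity
    exact nonneg_of_mul_nonneg_right (h4.trans this) (by linarith)
  have h5 := congrArg norm h3
  rw [norm_mul, Complex.norm_real, Complex.norm_real, norm_neg, Real.norm_of_nonneg,
    Real.norm_of_nonneg] at h5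
  · exact h5
  · exact div_nonneg hr0 (ketNormSq_pos hN J).le
  · exact mul_nonneg (by linarith) (by linarith)

theorem expect_JJ_isTheta (hN : 2 ≤ N) {i j : Fin N} (hij : i ≠ j) :
    (fun J : ℕ => expect J (JJ (L N) i j)) =Θ[Filter.atTop] (fun J : ℕ => (J : ℝ) ^ 2) := by
  have hN' : (2 : ℝ) ≤ N := by exact_mod_cast hN
  constructor
  · refine Asymptotics.IsBigO.of_bound 2 (Filter.Eventually.of_forall fun J => ?_)
    have h1 := norm_expect_JJ hN J hij
    have h2 := (tsum_casimirSum_bounds (N := N) J).2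
    rw [← div_le_iff₀ (ketNormSq_pos hN J), ← h1] at h2
    -- Dropping `N(N-1) ≥ 1` leaves `J² + J ≤ 2J²`, whence the constant `2`, valid for every `J`.
    have h3 : ‖expect J (JJ (L N) i j)‖ ≤ N * (N - 1) * ‖expect J (JJ (L N) i j)‖ :=
      le_mul_of_one_le_left (norm_nonneg _) (by nlinarith)
    have h4 : (J : ℝ) ≤ J ^ 2 := by exact_mod_cast Nat.le_self_pow two_ne_zero J
    rw [Real.norm_of_nonneg (by positivity)]
    linarith
  -- One factor `N` comes from Cauchy–Schwarz, and `N(N-1)` from the two symmetry reductions.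
  · refine Asymptotics.IsBigO.of_bound (N * (N * (N - 1))) (Filter.Eventually.of_forall fun J => ?_)
    have h1 := norm_expect_JJ hN J hij
    have h2 := (tsum_casimirSum_bounds (N := N) J).1
    rw [← le_div_iff₀ (ketNormSq_pos hN J), mul_div_assoc, ← h1] at h2
    rw [Real.norm_of_nonneg (by positivity)]
    linarith

end Asymptotics

end SimplicityUN

end

open SimplicityUN in
theorem mainTheorem5 (N : ℕ) (hN : 2 ≤ N) :
    -- the constraints `C_ii` are the diagonal simplicity constraints
    (∀ i : Fin N, C i i = E (L N) i i - E (R N) i i ∧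
      ∀ ψ : Amp (Mode4 N), C i i ψ = 0 ↔ JJ (L N) i i ψ = JJ (R N) i i ψ) ∧
    -- the closed `u(N)` algebra, with `C_ij† = C_ji`
    (∀ i j k l : Fin N,
      (⁅C i j, C k l⁆ : Module.End ℂ (Amp (Mode4 N))) =
        (if j = k then C i l else 0) - (if i = l then C k j else 0)) ∧
    (∀ (i j : Fin N) (φ ψ : Amp (Mode4 N)), φ ∈ finAmp (Mode4 N) →
      braket φ (C i j ψ) = braket (C j i φ) ψ) ∧
    -- the common kernel is the space of `U(N)`-invariant intertwiners
    (∀ ψ : Fock (Mode4 N),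
      ψ ∈ HC N ↔ ψ ∈ spin4Intertwiners N ∧ IsUNInvariant (amp (Mode4 N) ψ)) ∧
    -- in each `H_N^{(J),L} ⊗ H_N^{(J),R}` the kernel is the line spanned by `|J⟩`
    (∀ J : ℕ, ket N J ≠ 0 ∧ HC N ⊓ sector N J = Submodule.span ℂ {ket N J} ∧
      Module.finrank ℂ ↥(HC N ⊓ sector N J) = 1) ∧
    -- `H_C` is the orthogonal Hilbert space direct sum of these lines
    (∀ J K : ℕ, J ≠ K → inner ℂ (ket N J) (ket N K) = 0) ∧
    HC N = (⨆ J : ℕ, Submodule.span ℂ {ket N J}).topologicalClosure ∧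
    -- the cross simplicity constraints hold weakly on `H_C`, up to the correction `½ (E^R_j - E^R_i)`
    (∀ i j : Fin N, i ≠ j →
      (∀ φ ∈ HC N, ∀ ψ ∈ HC N,
        Normalizable (JJ (L N) i j (amp _ ψ)) → Normalizable (JJ (R N) i j (amp _ ψ)) →
        Normalizable (E (R N) i i (amp _ ψ)) → Normalizable (E (R N) j j (amp _ ψ)) →
        braket (amp _ φ) (JJ (L N) i j (amp _ ψ)) =
          braket (amp _ φ) (JJ (R N) i j (amp _ ψ)) +
            braket (amp _ φ) (((1 / 2 : ℂ) • (E (R N) j j - E (R N) i i)) (amp _ ψ))) ∧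
      -- the correction is of order `j` ...
      (∀ J : ℕ, ∀ φ ∈ HC N, ∀ ψ ∈ HC N ⊓ sector N J,
        ‖braket (amp _ φ) (JJ (L N) i j (amp _ ψ)) - braket (amp _ φ) (JJ (R N) i j (amp _ ψ))‖
          ≤ J * ‖φ‖ * ‖ψ‖) ∧
      -- ... whereas the expectation values of the scalar products are of order `j²`
      (fun J : ℕ => expect J (JJ (L N) i j)) =Θ[Filter.atTop] (fun J : ℕ => (J : ℝ) ^ 2) ∧
      (fun J : ℕ => expect J (JJ (R N) i j)) =Θ[Filter.atTop] (fun J : ℕ => (J : ℝ) ^ 2)) := by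
  refine ⟨fun i => ⟨rfl, C_self_eq_zero_iff i⟩, C_bracket, fun i j φ ψ hφ => braket_C i j hφ ψ,
    fun ψ => ?_, fun J => ⟨ket_ne_zero hN J, HC_inf_sector hN J, ?_⟩,
    fun J K h => inner_ket_ket h, HC_eq_topologicalClosure hN, fun i j hij => ⟨?_, ?_, ?_, ?_⟩⟩
  · rw [HC_eq_comap, Submodule.mem_comap, mem_solutions_iff, isUNInvariant_iff, ← and_assoc]
    rfl
  · rw [HC_inf_sector hN J]
    exact finrank_span_singleton (ket_ne_zero hN J)
  · intro φ hφ ψ hψ _ _ _ _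
    -- The two scalar products agree as coefficient families and the correction term is zero.
    rw [JJ_L_apply hψ hij, braket_E_sub_E hN hφ hψ, add_zero]
  · intro J φ _ ψ hψ
    rw [JJ_L_apply hψ.1 hij, sub_self, norm_zero]
    positivity
  · exact expect_JJ_isTheta hN hij
  · have h : (fun J : ℕ => expect J (JJ (R N) i j)) = fun J : ℕ => expect J (JJ (L N) i j) :=
      funext fun J => by rw [expect, expect, JJ_L_apply (ketAmp_mem_solutions J) hij]
    rw [h]
    exact expect_JJ_isTheta hN hij
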